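/- Let $\lambda:\mathbb{Z}_+=\{0,1,2,\dots\}\to(0,\infty)$ satisfy $0<\inf_x\lambda(x)\le\sup_x\lambda(x)<\infty$. Write $[\nabla^+f](x)=f(x+1)-f(x)$ and $[\nabla^-f](x)=f(x-1)-f(x)$, and let $\mathsf{L}=\lambda(x)\nabla^+_x$ be the generator of the pure-birth chain that jumps from $x$ to $x+1$ at rate $\lambda(x)$. Let $(e^{t\mathsf{L}})_{t\ge0}$ be its semigroup (the exponential of the bounded operator $t\mathsf{L}$ on bounded functions), $e^{t\mathsf{L}}(x,y)=[e^{t\mathsf{L}}\mathbf{1}_{\{y\}}](x)$ its transition density, and $\mathbf{1}_{[\![0,y]\!]}$ the indicator function of $\{0,\dots,y\}$ (zero if $y=-1$). For $N\ge 0$ let $$\mathbb{W}^{N,N+1}=\{(y,x)\in\mathbb{Z}_+^{N}\times\mathbb{Z}_+^{N+1}: x_1\le y_1<x_2\le\cdots\le y_N<x_{N+1}\},$$ and for $t\ge0$, $(y,x),(y',x')\in\mathbb{W}^{N,N+1}$ put $$\mathsf{U}_t[(y,x),(y',x')]=\det\begin{pmatrix}\mathsf{A}_t&\mathsf{B}_t\\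 \mathsf{C}_t&\mathsf{D}_t\end{pmatrix},$$ the determinant of size $2N+1$ with blocks $$(\mathsf{A}_t)_{ij}=e^{t\mathsf{L}}(x_i,x'_j),\qquad (\mathsf{B}_t)_{ij}=\lambda(y'_j)^{-1}\bigl([e^{t\mathsf{L}}\mathbf{1}_{[\![0,y'_j]\!]}](x_i)-\mathbf{1}(j\ge i)\bigr),$$ $$(\mathsf{C}_t)_{ij}=\lambda(y_i)\nabla^+_{y_i}\nabla^-_{x'_j}[e^{t\mathsf{L}}\mathbf{1}_{[\![0,x'_j]\!]}](y_i),\qquad (\mathsf{D}_t)_{ij}=e^{t\mathsf{L}}(y_i,y'_j),$$ of sizes $(N+1)\times(N+1)$, $(N+1)\times N$, $N\times(N+1)$ and $N\times N$. The two-level push-block dynamics is the following continuous-time Markov chain on $\mathbb{W}^{N,N+1}$ with a cemetery. In state $(y,x)$ each of the $2N+1$ particles carries an independent exponential clock whose rate is $\lambda$ at its position, and the particle whose clock rings first attempts to jump to the right by one; after each ring the clocks are renewed. If $X$-particle $i$ rings, it moves to $x_i+1$ unless this breaks the interlacing, in which case the jump is blocked and nothing changes. If $Y$-particle $i$ rings,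 it moves to $y_i+1$; if this is the position of another $Y$-particle, the process is killed, and otherwise, if the interlacing with $x_{i+1}$ is broken, $x_{i+1}$ is pushed to $x_{i+1}+1$ at the same time. Then $\mathsf{U}_t$ is the transition density of this dynamics. Precisely: 1. $\mathsf{U}_t\ge0$ and $\sum_{z'}\mathsf{U}_t[z,z']\le1$ for all $t\ge0$ and $z\in\mathbb{W}^{N,N+1}$. 2. $\mathsf{U}_0[z,z']=\mathbf{1}(z=z')$, and $\mathsf{U}_t$ solves the Kolmogorov backward equation: for all $t\ge0$ (one-sided derivative at $t=0$) and $z,z'\in\mathbb{W}^{N,N+1}$, $\frac{d}{dt}\mathsf{U}_t[z,z']=\sum_{a}\lambda(z_a)\bigl(\mathsf{U}_t[z^{a},z']-\mathsf{U}_t[z,z']\bigr)$, where the sum is over the $2N+1$ particles, $z_a$ is the position of particle $a$, $z^{a}$ is the state after its clock rings, and $\mathsf{U}_t[z^a,z']=0$ if the process is then killed. 3. If $(Z(t))_{t\ge0}$ is the dynamics started from $z_0\in\mathbb{W}^{N,N+1}$, then for all $n\ge0$, $0=t_0\le t_1\le\dots\le t_n$ and $z_1,\dots,z_n\in\mathbb{W}^{N,N+1}$,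 $$\mathbb{P}\bigl(Z(t_k)=z_k,\ 0\le k\le n\bigr)=\prod_{k=0}^{n-1}\mathsf{U}_{t_{k+1}-t_k}[z_k,z_{k+1}].$$ In particular $\mathbb{P}(Z(t)=z')=\mathsf{U}_t[z_0,z']$ for all $t\ge 0$ and $z'\in\mathbb{W}^{N,N+1}$. -/

import Mathlib

namespace TwoLevel

noncomputable section

/-! ### The pure-birth chain -/

/-- The standing assumption on the rates: they are uniformly bounded away from `0` and `∞`. -/
def UniformlyBounded (lam : ℕ → ℝ) : Prop :=
  ∃ s M : ℝ, 0 < s ∧ ∀ x, s ≤ lam x ∧ lam x ≤ M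

/-- The forward discrete derivative `(∇⁺ f)(x) = f (x + 1) - f x`. -/
def nablaPlus (f : ℕ → ℝ) (x : ℕ) : ℝ := f (x + 1) - f x

/-- The backward discrete derivative `(∇⁻ f)(x) = f (x - 1) - f x`, on the integers. -/
def nablaMinus (f : ℤ → ℝ) (x : ℤ) : ℝ := f (x - 1) - f x

/-- The generator `L = lam ∇⁺` of the pure-birth chain. -/
def birthGenerator (lam : ℕ → ℝ) (f : ℕ → ℝ) (x : ℕ) : ℝ := lam x * nablaPlus f x

/-- The semigroup `e^{tL} f = ∑ₙ tⁿ/n! Lⁿ f` of the pure-birth chain. For bounded rates `L` is a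
bounded operator on the bounded functions on `ℕ`, and this is its exponential; the convergence of
the series is `summable_birthSemigroup` below. -/
def birthSemigroup (lam : ℕ → ℝ) (t : ℝ) (f : ℕ → ℝ) (x : ℕ) : ℝ :=
  ∑' n : ℕ, t ^ n / (n.factorial : ℝ) * (birthGenerator lam)^[n] f x

theorem summable_birthSemigroup {lam : ℕ → ℝ} (hlam : UniformlyBounded lam) (t : ℝ)
    {f : ℕ → ℝ} {K : ℝ} (hf : ∀ x, |f x| ≤ K) (x : ℕ) :
    Summable fun n : ℕ => t ^ n / (n.factorial : ℝ) * (birthGenerator lam)^[n] f x := by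
  obtain ⟨s, M, hs, h⟩ := hlam
  have hM : 0 ≤ M := by linarith [(h 0).1, (h 0).2]
  have key : ∀ n x, |(birthGenerator lam)^[n] f x| ≤ (2 * M) ^ n * K := by
    intro n
    induction n with
    | zero => intro x; simpa using hf x
    | succ n ih =>
      intro x
      rw [Function.iterate_succ_apply', birthGenerator, nablaPlus, abs_mul,
        abs_of_pos (lt_of_lt_of_le hs (h x).1)]
      have h1 := ih x
      have h2 := ih (x + 1)
      have h3 := abs_sub ((birthGenerator lam)^[n] f (x + 1)) ((birthGenerator lam)^[n] f x)
      calc _ ≤ M * ((2 * M) ^ n * K + (2 * M) ^ n * K) :=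
            mul_le_mul (h x).2 (by linarith) (abs_nonneg _) hM
        _ = _ := by ring
  refine Summable.of_norm_bounded (g := fun n : ℕ => (|t| * (2 * M)) ^ n / (n.factorial : ℝ) * K)
    ((Real.summable_pow_div_factorial _).mul_right K) fun n => ?_
  rw [Real.norm_eq_abs, abs_mul, abs_div, abs_pow, Nat.abs_cast]
  calc _ ≤ |t| ^ n / (n.factorial : ℝ) * ((2 * M) ^ n * K) := by
        gcongr
        exact key n x
    _ = _ := by rw [mul_pow]; ring

/-- The transition density `e^{tL}(x, y)` of the pure-birth chain. -/
def birthDensity (lam : ℕ → ℝ) (t : ℝ) (x y : ℕ) : ℝ :=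
  birthSemigroup lam t (Set.indicator {y} 1) x

/-- `(e^{tL} 1_{⟦0, y⟧})(x)`, where `⟦0, y⟧ = {0, 1, …, y}`, which is empty for `y = -1`. -/
def birthCumul (lam : ℕ → ℝ) (t : ℝ) (x : ℕ) (y : ℤ) : ℝ :=
  birthSemigroup lam t (Set.indicator {k : ℕ | (k : ℤ) ≤ y} 1) x

/-! ### Interlacing pairs -/

/-- The interlacing condition `x₁ ≤ y₁ < x₂ ≤ ⋯ ≤ y_N < x_{N+1}`. -/
def Interlaces {N : ℕ} (y : Fin N → ℕ) (x : Fin (N + 1) → ℕ) : Prop :=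
  ∀ i : Fin N, x i.castSucc ≤ y i ∧ y i < x i.succ

/-- The space `𝕎^{N,N+1}` of interlacing pairs `(y, x)`. -/
@[ext]
structure State (N : ℕ) where
  y : Fin N → ℕ
  x : Fin (N + 1) → ℕ
  interlaces : Interlaces y x

/-! ### The block determinant kernel -/

/-- The block `A_t`. -/
def blockA (lam : ℕ → ℝ) (t : ℝ) {N : ℕ} (z z' : State N) :
    Matrix (Fin (N + 1)) (Fin (N + 1)) ℝ :=
  Matrix.of fun i j => birthDensity lam t (z.x i) (z'.x j)

/-- The block `B_t`. -/
def blockB (lam : ℕ → ℝ) (t : ℝ) {N : ℕ} (z z' : State N) :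
    Matrix (Fin (N + 1)) (Fin N) ℝ :=
  Matrix.of fun i j =>
    (lam (z'.y j))⁻¹ *
      (birthCumul lam t (z.x i) (z'.y j) - if (i : ℕ) ≤ (j : ℕ) then 1 else 0)

/-- The block `C_t`. -/
def blockC (lam : ℕ → ℝ) (t : ℝ) {N : ℕ} (z z' : State N) :
    Matrix (Fin N) (Fin (N + 1)) ℝ :=
  Matrix.of fun i j =>
    lam (z.y i) *
      nablaPlus (fun u => nablaMinus (fun v => birthCumul lam t u v) (z'.x j)) (z.y i)

/-- The block `D_t`. -/
def blockD (lam : ℕ → ℝ) (t : ℝ) {N : ℕ} (z z' : State N) :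
    Matrix (Fin N) (Fin N) ℝ :=
  Matrix.of fun i j => birthDensity lam t (z.y i) (z'.y j)

/-- The two-level Karlin–McGregor kernel `U_t^{N,N+1}[(y, x), (y', x')]`. -/
def kernelU (lam : ℕ → ℝ) (t : ℝ) {N : ℕ} (z z' : State N) : ℝ :=
  (Matrix.fromBlocks (blockA lam t z z') (blockB lam t z z')
    (blockC lam t z z') (blockD lam t z z')).det

/-! ### The two-level push-block dynamics -/

/-- The `2N+1` particles: `inl i` is the `i`-th `Y`-particle, `inr i` the `i`-th `X`-particle. -/
abbrev Particle (N : ℕ) : Type := Fin N ⊕ Fin (N + 1)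

/-- The position of a particle. -/
def State.pos {N : ℕ} (z : State N) : Particle N → ℕ
  | Sum.inl i => z.y i
  | Sum.inr i => z.x i

/-- The `X`-configuration after the `i`-th `Y`-particle has moved one step to the right: if the
move breaks the interlacing with `x_{i+1}`, then `x_{i+1}` is pushed to the right by one. -/
def State.pushedX {N : ℕ} (z : State N) (i : Fin N) : Fin (N + 1) → ℕ :=
  if z.y i + 1 < z.x i.succ then z.x
  else Function.update z.x i.succ (z.x i.succ + 1)

/-- A move of a `Y`-particle that does not collide with another `Y`-particle, together with the
push it may trigger, preserves the interlacing. -/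
theorem State.interlaces_pushedX {N : ℕ} (z : State N) (i : Fin N)
    (h : ¬ ∃ j, z.y j = z.y i + 1) :
    Interlaces (Function.update z.y i (z.y i + 1)) (z.pushedX i) := by
  intro k
  have hk := z.interlaces k
  have hi := z.interlaces i
  have hne : z.y k ≠ z.y i + 1 := fun e => h ⟨k, e⟩
  unfold State.pushedX
  by_cases hki : k = i
  · subst hki
    have h1 : k.castSucc ≠ k.succ := (Fin.castSucc_lt_succ (i := k)).ne
    split_ifs with hp
    · simp only [Function.update_self]; omega
    · simp only [Function.update_self, Function.update_of_ne h1]; omega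
  · have h1 : k.succ ≠ i.succ := fun e => hki (Fin.succ_injective _ e)
    split_ifs with hp
    · simp only [Function.update_of_ne hki]; omega
    · simp only [Function.update_of_ne hki, Function.update_of_ne h1]
      by_cases hc : k.castSucc = i.succ
      · rw [hc] at hk
        rw [hc, Function.update_self]
        omega
      · rw [Function.update_of_ne hc]
        omega

open Classical in
/-- The `i`-th `Y`-particle jumps to the right by one, pushing `x_{i+1}` if necessary; the
process is killed (`none`) if this makes two `Y`-particles collide. -/
def State.ringY {N : ℕ} (z : State N) (i : Fin N) : Option (State N) :=
  if h : ∃ j, z.y j = z.y i + 1 then none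
  else some ⟨Function.update z.y i (z.y i + 1), z.pushedX i, z.interlaces_pushedX i h⟩

open Classical in
/-- The `i`-th `X`-particle jumps to the right by one, unless this breaks the interlacing, in
which case the jump is blocked. -/
def State.ringX {N : ℕ} (z : State N) (i : Fin (N + 1)) : State N :=
  if h : Interlaces z.y (Function.update z.x i (z.x i + 1)) then
    ⟨z.y, Function.update z.x i (z.x i + 1), h⟩
  else z

/-- The state after the clock of particle `a` has rung (`none` if the process is killed). -/
def State.ring {N : ℕ} (z : State N) : Particle N → Option (State N)
  | Sum.inl i => z.ringY i
  | Sum.inr i => some (z.ringX i)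

/-- The generator of the dynamics:
`(G f)(z) = ∑ₐ lam (position of a) * (f (state after a rings) - f z)`, where `f` is `0` at the
cemetery. -/
def generator (lam : ℕ → ℝ) {N : ℕ} (f : State N → ℝ) (z : State N) : ℝ :=
  ∑ a : Particle N, lam (z.pos a) * ((z.ring a).elim 0 f - f z)

/-- The time until the clock of particle `a` rings in state `z`, when `e a` are standard
exponential variables: an exponential variable of rate `lam (z.pos a)`. -/
def clockTime (lam : ℕ → ℝ) {N : ℕ} (z : State N) (e : Particle N → ℝ) (a : Particle N) : ℝ :=
  e a / lam (z.pos a)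

/-- The particle whose clock rings first in state `z`. -/
def firstRing (lam : ℕ → ℝ) {N : ℕ} (z : State N) (e : Particle N → ℝ) : Particle N :=
  (Finite.exists_min (clockTime lam z e)).choose

/-- The time and the state (`none` once killed) right after the `n`-th ring, for the process
started from `z`, where `e (n, a)` is the standard exponential variable that drives the clock of
particle `a` between the `n`-th and the `(n+1)`-st ring. -/
def ringChain (lam : ℕ → ℝ) {N : ℕ} (z : State N) (e : ℕ × Particle N → ℝ) :
    ℕ → ℝ × Option (State N)
  | 0 => (0, some z)
  | n + 1 =>
    match ringChain lam z e n with
    | (s, none) => (s, none)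
    | (s, some w) =>
      let b := firstRing lam w (fun a => e (n, a))
      (s + clockTime lam w (fun a => e (n, a)) b, w.ring b)

open Classical in
/-- The state at time `t` of the two-level push-block dynamics started from `z` (`none` once
killed): the state after the last ring up to time `t`. -/
def process (lam : ℕ → ℝ) {N : ℕ} (z : State N) (e : ℕ × Particle N → ℝ) (t : ℝ) :
    Option (State N) :=
  if h : ∃ n, (ringChain lam z e n).1 ≤ t ∧ t < (ringChain lam z e (n + 1)).1 then
    (ringChain lam z e (Nat.find h)).2
  else none

end

end TwoLevel

/-!
The row of `U_t` attached to a particle depends on the configuration only through the position of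
that particle, and each of its entries is `e^{tL}` applied to a fixed function, up to a constant.
Hence the determinant, as a function of arbitrary positions of the particles, solves the backward
equation of `2N + 1` independent birth chains. The interactions are boundary conditions. The row of
a `Y`-particle is `-L` of the row of an `X`-particle, so when `x_i = y_k` moving `x_i` one step to
the right changes its row by a multiple of the row of `y_k` and leaves the determinant unchanged:
for `k = i` this is blocking and for `k = i - 1` pushing. When two `Y`-particles meet, two rows
coincide: this is killing.

Conditioning the dynamics on its first ring shows that the probability of a path, as a function of
the initial state and of the time of the first observation, solves a renewal equation, the
integrated form of the backward equation. This equation has only one bounded solution with given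
values at time `0`, which gives at once the transition density and the Markov property.
Nonnegativity and substochasticity of `U_t`, invisible from the determinant, follow.
-/

namespace TwoLevel

open MeasureTheory ProbabilityTheory BoundedContinuousFunction
open scoped Topology ENNReal

noncomputable section

/-! ### The birth semigroup as an operator exponential -/

section ExpSemigroup

variable {E : Type*} [NormedAddCommGroup E] [NormedSpace ℝ E]

/-- The uniformly continuous semigroup `e^{tA}` generated by a bounded operator `A`. -/
def expSemigroup (A : E →L[ℝ] E) (t : ℝ) : E →L[ℝ] E := NormedSpace.exp (t • A)

theorem expSemigroup_zero (A : E →L[ℝ] E) : expSemigroup A 0 = .id ℝ E := by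
  rw [expSemigroup, zero_smul, NormedSpace.exp_zero]
  rfl

theorem expSemigroup_comm_apply (A : E →L[ℝ] E) (t : ℝ) (v : E) :
    expSemigroup A t (A v) = A (expSemigroup A t v) :=
  congr($((((Commute.refl A).smul_left t).exp_left).eq) v)

variable [CompleteSpace E]

theorem hasSum_expSemigroup_apply (A : E →L[ℝ] E) (t : ℝ) (v : E) :
    HasSum (fun n : ℕ => (t ^ n / (n.factorial : ℝ)) • (A ^ n) v) (expSemigroup A t v) := by
  have h := (ContinuousLinearMap.apply ℝ E v).hasSum
    (NormedSpace.exp_series_hasSum_exp' (𝕂 := ℝ) (t • A))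
  simpa [expSemigroup, smul_pow, smul_smul, div_eq_inv_mul] using h

theorem hasDerivAt_expSemigroup_apply (A : E →L[ℝ] E) (t : ℝ) (v : E) :
    HasDerivAt (fun r => expSemigroup A r v) (A (expSemigroup A t v)) t :=
  (ContinuousLinearMap.apply ℝ E v).hasFDerivAt.comp_hasDerivAt t
    (hasDerivAt_exp_smul_const' A t)

end ExpSemigroup

section Kernel

/-- The generator `L = lam ∇⁺` as a bounded operator on the bounded functions on `ℕ`. -/
def birthOperator (lam : ℕ →ᵇ ℝ) : (ℕ →ᵇ ℝ) →L[ℝ] (ℕ →ᵇ ℝ) :=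
  ContinuousLinearMap.mul ℝ (ℕ →ᵇ ℝ) lam ∘L
    (compContinuousCLM ℝ ℝ ⟨Nat.succ, continuous_of_discreteTopology⟩ - .id ℝ _)

/-- The indicator function of a set of natural numbers, as a bounded function. -/
def bddIndicator (s : Set ℕ) : ℕ →ᵇ ℝ := .indicator s (isClopen_discrete s)

theorem bddIndicator_apply (s : Set ℕ) (x : ℕ) : bddIndicator s x = s.indicator 1 x := rfl

variable (lam : ℕ →ᵇ ℝ)

theorem birthOperator_apply (f : ℕ →ᵇ ℝ) (x : ℕ) :
    birthOperator lam f x = lam x * (f (x + 1) - f x) := rfl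

theorem birthOperator_const (c : ℝ) : birthOperator lam (const ℕ c) = 0 := by
  ext x
  simp [birthOperator_apply]

theorem birthOperator_bddIndicator_Iic (y : ℕ) :
    birthOperator lam (bddIndicator (Set.Iic y)) = -(lam y • bddIndicator {y}) := by
  ext x
  simp only [birthOperator_apply, bddIndicator_apply, Set.indicator_apply, Set.mem_Iic,
    BoundedContinuousFunction.neg_apply, BoundedContinuousFunction.smul_apply,
    Set.mem_singleton_iff, Pi.one_apply, smul_eq_mul]
  rcases lt_trichotomy x y with h | rfl | h
  · simp [h.le, h.ne, Nat.succ_le_of_lt h]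
  · simp
  · simp [h.not_ge, h.ne', (h.trans x.lt_succ_self).not_ge]

theorem coe_birthOperator_pow_apply (n : ℕ) (f : ℕ →ᵇ ℝ) :
    ⇑((birthOperator lam ^ n) f) = (birthGenerator lam)^[n] f := by
  induction n with
  | zero => rfl
  | succ n ih =>
    rw [Function.iterate_succ_apply', ← ih, pow_succ']
    rfl

theorem birthSemigroup_coe (t : ℝ) (f : ℕ →ᵇ ℝ) (x : ℕ) :
    birthSemigroup lam t f x = expSemigroup (birthOperator lam) t f x := by
  have h := (hasSum_expSemigroup_apply (birthOperator lam) t f).mapL (evalCLM ℝ x)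
  refine (tsum_congr fun n => ?_).trans h.tsum_eq
  rw [← coe_birthOperator_pow_apply]
  rfl

theorem birthDensity_eq_expSemigroup (t : ℝ) (x y : ℕ) :
    birthDensity lam t x y = expSemigroup (birthOperator lam) t (bddIndicator {y}) x :=
  birthSemigroup_coe lam t (bddIndicator {y}) x

theorem birthCumul_eq_expSemigroup (t : ℝ) (x y : ℕ) :
    birthCumul lam t x y = expSemigroup (birthOperator lam) t (bddIndicator (Set.Iic y)) x := by
  have hIic : {k : ℕ | (k : ℤ) ≤ y} = Set.Iic y := by
    ext k
    simp
  rw [birthCumul, hIic]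
  exact birthSemigroup_coe lam t (bddIndicator (Set.Iic y)) x

theorem nablaMinus_birthCumul (t : ℝ) (x y : ℕ) :
    nablaMinus (fun v => birthCumul lam t x v) y = -birthDensity lam t x y := by
  have hsplit : bddIndicator (Set.Iic y) = bddIndicator (Set.Iio y) + bddIndicator {y} := by
    ext k
    rcases lt_trichotomy k y with h | rfl | h
    · simp [bddIndicator_apply, h, h.le, h.ne]
    · simp [bddIndicator_apply]
    · simp [bddIndicator_apply, h.not_ge, h.not_gt, h.ne']
  have hIio : {k : ℕ | (k : ℤ) ≤ (y : ℤ) - 1} = Set.Iio y := by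
    ext k
    simp
  have hlower : birthCumul lam t x ((y : ℤ) - 1) =
      expSemigroup (birthOperator lam) t (bddIndicator (Set.Iio y)) x := by
    rw [birthCumul, hIio]
    exact birthSemigroup_coe lam t (bddIndicator (Set.Iio y)) x
  rw [nablaMinus, hlower, birthCumul_eq_expSemigroup, birthDensity_eq_expSemigroup, hsplit, map_add]
  exact sub_add_cancel_left _ _

/-! ### The determinant as a function of the particle positions -/

theorem hasDerivAt_det_of_rows {n : Type*} [Fintype n] [DecidableEq n] {M : ℝ → Matrix n n ℝ}
    {M' : Matrix n n ℝ} {t : ℝ} (h : ∀ i j, HasDerivAt (fun r => M r i j) (M' i j) t) :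
    HasDerivAt (fun r => (M r).det) (∑ i, ((M t).updateRow i (M' i)).det) t := by
  let det : ContinuousMultilinearMap ℝ (fun _ : n => n → ℝ) ℝ :=
    ⟨Matrix.detRowAlternating.toMultilinearMap, continuous_id.matrix_det⟩
  have hrows : HasDerivAt (fun r i => M r i) (fun i => M' i) t :=
    hasDerivAt_pi.2 fun i => hasDerivAt_pi.2 (h i)
  exact ((det.hasFDerivAt (M t)).comp_hasDerivAt t hrows).congr_deriv
    (det.linearDeriv_apply (M t) M')

theorem det_updateRow_smul_sub {R n : Type*} [CommRing R] [Fintype n] [DecidableEq n]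
    (M : Matrix n n R) (i : n) (c : R) (u v : n → R) :
    (M.updateRow i (c • (u - v))).det = c * ((M.updateRow i u).det - (M.updateRow i v).det) := by
  rw [Matrix.det_updateRow_smul]
  exact congrArg _ (Matrix.detRowAlternating.map_update_sub M i u v)

variable {N : ℕ}

/-- The function on which the semigroup acts in the column of particle `b` of the determinant. -/
def columnFun (z' : State N) : Particle N → (ℕ →ᵇ ℝ)
  | .inl j => (lam (z'.y j))⁻¹ • bddIndicator (Set.Iic (z'.y j))
  | .inr j => bddIndicator {z'.x j}

/-- The constants subtracted in the block `B_t`. -/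
def staircase (z' : State N) : Particle N → Particle N → ℝ
  | .inr i, .inl j => if (i : ℕ) ≤ j then (lam (z'.y j))⁻¹ else 0
  | _, _ => 0

/-- The entry in row `a` and column `b` of the determinant, as a function of the position of
particle `a`. The rows of the `Y`-particles are obtained from those of the `X`-particles by applying
`-L`, which turns `lam(y)⁻¹ 1_{⟦0, y⟧}` into `1_{y}` and annihilates the constants. -/
def entry (t : ℝ) (z' : State N) : Particle N → Particle N → (ℕ →ᵇ ℝ)
  | .inl _, b => -birthOperator lam (expSemigroup (birthOperator lam) t (columnFun lam z' b))
  | .inr i, b => expSemigroup (birthOperator lam) t (columnFun lam z' b) -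
      const ℕ (staircase lam z' (.inr i) b)

/-- The matrix behind `kernelU`, for arbitrary positions `p` of the particles and with its rows and
columns indexed by the particles. -/
def particleMatrix (t : ℝ) (z' : State N) (p : Particle N → ℕ) :
    Matrix (Particle N) (Particle N) ℝ :=
  Matrix.of fun a b => entry lam t z' a b (p a)

theorem birthOperator_entry_inr (t : ℝ) (z' : State N) (i : Fin (N + 1)) (k : Fin N)
    (b : Particle N) :
    birthOperator lam (entry lam t z' (.inr i) b) = -entry lam t z' (.inl k) b := by
  rw [entry, entry, map_sub, birthOperator_const, sub_zero, neg_neg]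

theorem hasDerivAt_entry (t : ℝ) (z' : State N) (a b : Particle N) :
    HasDerivAt (fun r => entry lam r z' a b) (birthOperator lam (entry lam t z' a b)) t := by
  have h := hasDerivAt_expSemigroup_apply (birthOperator lam) t (columnFun lam z' b)
  rcases a with i | i
  · rw [entry, map_neg]
    exact ((birthOperator lam).hasFDerivAt.comp_hasDerivAt t h).neg
  · rw [entry, map_sub, birthOperator_const, sub_zero]
    exact h.sub_const _

theorem particleMatrix_update (t : ℝ) (z' : State N) (p : Particle N → ℕ) (a : Particle N)
    (u : ℕ) :
    particleMatrix lam t z' (Function.update p a u) =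
      (particleMatrix lam t z' p).updateRow a fun b => entry lam t z' a b u := by
  ext c b
  rcases eq_or_ne c a with rfl | hca
  · simp [particleMatrix]
  · simp [particleMatrix, hca]

theorem hasDerivAt_det_particleMatrix (t : ℝ) (z' : State N) (p : Particle N → ℕ) :
    HasDerivAt (fun r => (particleMatrix lam r z' p).det)
      (∑ a, lam (p a) * ((particleMatrix lam t z' (Function.update p a (p a + 1))).det -
        (particleMatrix lam t z' p).det)) t := by
  have hentry (a b : Particle N) := (evalCLM ℝ (p a)).hasFDerivAt.comp_hasDerivAt t
    (hasDerivAt_entry lam t z' a b)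
  refine (hasDerivAt_det_of_rows (M := fun r => particleMatrix lam r z' p)
    (M' := .of fun a b => birthOperator lam (entry lam t z' a b) (p a)) hentry).congr_deriv ?_
  refine Finset.sum_congr rfl fun a _ => ?_
  rw [particleMatrix_update]
  refine (det_updateRow_smul_sub _ a (lam (p a)) (fun b => entry lam t z' a b (p a + 1))
    (particleMatrix lam t z' p a)).trans ?_
  rw [Matrix.updateRow_eq_self]

theorem det_particleMatrix_update_of_pos_eq (hlam : ∀ u, lam u ≠ 0) (t : ℝ) (z' : State N)
    {p : Particle N → ℕ} {i : Fin (N + 1)} {k : Fin N} (h : p (.inr i) = p (.inl k)) :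
    (particleMatrix lam t z' (Function.update p (.inr i) (p (.inr i) + 1))).det =
      (particleMatrix lam t z' p).det := by
  have hrow : (fun b => entry lam t z' (.inr i) b (p (.inr i) + 1)) =
      particleMatrix lam t z' p (.inr i) +
        (-(lam (p (.inr i)))⁻¹) • particleMatrix lam t z' p (.inl k) := by
    funext b
    have hL := congr($(birthOperator_entry_inr lam t z' i k b) (p (.inr i)))
    rw [birthOperator_apply, BoundedContinuousFunction.neg_apply] at hL
    have := hlam (p (.inr i))
    simp only [particleMatrix, Matrix.of_apply, Pi.add_apply, Pi.smul_apply, smul_eq_mul, ← h]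
    field_simp
    linarith
  rw [particleMatrix_update, hrow, Matrix.det_updateRow_add_smul_self _ (by simp)]

theorem det_particleMatrix_eq_zero (t : ℝ) (z' : State N) {p : Particle N → ℕ} {i k : Fin N}
    (hik : i ≠ k) (h : p (.inl i) = p (.inl k)) : (particleMatrix lam t z' p).det = 0 :=
  Matrix.det_zero_of_row_eq (i := .inl i) (j := .inl k) (by simpa using hik)
    (funext fun b => congrArg (entry lam t z' (.inl i) b) h)

theorem exists_abs_det_particleMatrix_le (z' : State N) (T : ℝ) :
    ∃ K, ∀ t ∈ Set.Icc 0 T, ∀ p, |(particleMatrix lam t z' p).det| ≤ K := by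
  have hcont : Continuous fun t => entry lam t z' := continuous_pi fun a => continuous_pi fun b =>
    continuous_iff_continuousAt.2 fun t => (hasDerivAt_entry lam t z' a b).continuousAt
  obtain ⟨C, hC⟩ := isCompact_Icc.exists_bound_of_continuousOn (s := Set.Icc 0 T) hcont.continuousOn
  refine ⟨(Fintype.card (Particle N)).factorial • C ^ Fintype.card (Particle N),
    fun t ht p => Matrix.det_le (abv := AbsoluteValue.abs) fun a b => ?_⟩
  calc |entry lam t z' a b (p a)| ≤ ‖entry lam t z' a b‖ :=
        (entry lam t z' a b).norm_coe_le_norm _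
    _ ≤ ‖entry lam t z'‖ := (norm_le_pi_norm _ b).trans (norm_le_pi_norm _ a)
    _ ≤ C := hC t ht

/-! ### The Kolmogorov backward equation -/

theorem kernelU_eq_det_particleMatrix (hlam : ∀ u, lam u ≠ 0) (t : ℝ) (z z' : State N) :
    kernelU lam t z z' = (particleMatrix lam t z' z.pos).det := by
  rw [kernelU, ← Matrix.det_submatrix_equiv_self (Equiv.sumComm _ _) (particleMatrix _ _ _ _)]
  congr 1
  ext (i | i) (j | j)
  · simp [blockA, particleMatrix, entry, columnFun, staircase, State.pos,
      birthDensity_eq_expSemigroup]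
  · simp [blockB, particleMatrix, entry, columnFun, staircase, State.pos,
      birthCumul_eq_expSemigroup, mul_sub]
  · simp only [blockC, nablaPlus, nablaMinus_birthCumul, birthDensity_eq_expSemigroup,
      sub_neg_eq_add, Matrix.fromBlocks_apply₂₁, Matrix.of_apply, particleMatrix, entry, columnFun,
      State.pos, Equiv.sumComm_apply, Matrix.submatrix_apply, Sum.swap_inr, Sum.swap_inl,
      BoundedContinuousFunction.coe_neg, Pi.neg_apply, birthOperator_apply]
    ring
  · simp [blockD, particleMatrix, entry, columnFun, State.pos, birthDensity_eq_expSemigroup,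
      ← expSemigroup_comm_apply, birthOperator_bddIndicator_Iic, hlam]

theorem State.pos_eq_elim (z : State N) : z.pos = Sum.elim z.y z.x := by
  ext (i | i) <;> rfl

theorem State.exists_y_eq_of_blocked {z : State N} {i : Fin (N + 1)}
    (h : ¬ Interlaces z.y (Function.update z.x i (z.x i + 1))) : ∃ k, z.x i = z.y k := by
  by_contra! hne
  refine h fun k => ?_
  have hk := z.interlaces k
  rcases eq_or_ne k.castSucc i with rfl | hi
  · have := hne k
    rw [Function.update_self, Function.update_of_ne (Fin.castSucc_lt_succ (i := k)).ne']
    omega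
  · rw [Function.update_of_ne hi]
    rcases eq_or_ne k.succ i with rfl | hi'
    · rw [Function.update_self]
      omega
    · rwa [Function.update_of_ne hi']

theorem det_particleMatrix_ringX (hlam : ∀ u, lam u ≠ 0) (t : ℝ) (z z' : State N)
    (i : Fin (N + 1)) :
    (particleMatrix lam t z' (Function.update z.pos (.inr i) (z.x i + 1))).det =
      kernelU lam t (z.ringX i) z' := by
  rw [kernelU_eq_det_particleMatrix lam hlam, State.ringX]
  split_ifs with h
  · rw [State.pos_eq_elim, State.pos_eq_elim, Sum.update_elim_inr]
  · obtain ⟨k, hk⟩ := State.exists_y_eq_of_blocked h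
    exact det_particleMatrix_update_of_pos_eq lam hlam t z' hk

theorem det_particleMatrix_ringY (hlam : ∀ u, lam u ≠ 0) (t : ℝ) (z z' : State N) (i : Fin N) :
    (particleMatrix lam t z' (Function.update z.pos (.inl i) (z.y i + 1))).det =
      (z.ringY i).elim 0 fun w => kernelU lam t w z' := by
  rw [State.ringY]
  split_ifs with h
  · obtain ⟨j, hj⟩ := h
    have hij : i ≠ j := by rintro rfl; omega
    refine det_particleMatrix_eq_zero lam t z' hij ?_
    rw [Function.update_self, Function.update_of_ne (by simpa using hij.symm)]
    exact hj.symm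
  · refine .trans ?_ (kernelU_eq_det_particleMatrix lam hlam t _ z').symm
    simp only [State.pos_eq_elim, State.pushedX, Sum.update_elim_inl]
    split_ifs with hp
    · rfl
    · have hpush : z.x i.succ = z.y i + 1 := by have := z.interlaces i; omega
      rw [← Sum.update_elim_inr]
      refine (det_particleMatrix_update_of_pos_eq lam hlam t z' (k := i) ?_).symm
      simpa using hpush

theorem hasDerivAt_kernelU (hlam : ∀ u, lam u ≠ 0) (t : ℝ) (z z' : State N) :
    HasDerivAt (fun r => kernelU lam r z z') (generator lam (fun w => kernelU lam t w z') z) t := by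
  simp only [kernelU_eq_det_particleMatrix lam hlam _ z]
  refine (hasDerivAt_det_particleMatrix lam t z' z.pos).congr_deriv ?_
  refine Finset.sum_congr rfl fun a _ => ?_
  rw [← kernelU_eq_det_particleMatrix lam hlam]
  rcases a with i | i
  · exact congrArg (fun d => lam (z.y i) * (d - _)) (det_particleMatrix_ringY lam hlam t z z' i)
  · exact congrArg (fun d => lam (z.x i) * (d - _)) (det_particleMatrix_ringX lam hlam t z z' i)

theorem exists_abs_kernelU_le (hlam : ∀ u, lam u ≠ 0) (z' : State N) (T : ℝ) :
    ∃ K, ∀ t ∈ Set.Icc 0 T, ∀ z, |kernelU lam t z z'| ≤ K := by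
  obtain ⟨K, hK⟩ := exists_abs_det_particleMatrix_le lam z' T
  exact ⟨K, fun t ht z => kernelU_eq_det_particleMatrix lam hlam t z z' ▸ hK t ht z.pos⟩

/-! ### The initial condition -/

theorem exists_rank_lt_perm {α : Type*} [Finite α] {rank : α → ℕ}
    (hrank : Function.Injective rank) {σ : Equiv.Perm α} (hσ : σ ≠ 1) :
    ∃ a, rank a < rank (σ a) ∧ rank a < rank (σ.symm a) := by
  have hmoved : {a | σ a ≠ a}.Nonempty := by
    by_contra! h
    exact hσ (Equiv.ext fun a => not_not.1 fun ha => h.subset ha)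
  obtain ⟨a, ha, hmin⟩ := Set.exists_min_image _ rank (Set.toFinite _) hmoved
  have ha' : σ.symm a ≠ a := fun h => ha (σ.symm_apply_eq.1 h).symm
  refine ⟨a, (hmin _ fun h => ha (σ.injective h)).lt_of_ne (hrank.ne (Ne.symm ha)),
    (hmin _ fun h => ha' ?_).lt_of_ne (hrank.ne ha'.symm)⟩
  rw [← h, σ.apply_symm_apply]

theorem det_eq_prod_diag_of_rank {R n : Type*} [CommRing R] [Fintype n] [DecidableEq n]
    {M : Matrix n n R} {rank : n → ℕ} (hrank : Function.Injective rank)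
    (hM : ∀ a b c, rank a < rank b → rank a < rank c → M b a = 0 ∨ M a c = 0) :
    M.det = ∏ a, M a a := by
  rw [Matrix.det_apply, Finset.sum_eq_single 1 (fun σ _ hσ => ?_) (by simp)]
  · simp
  obtain ⟨a, hσa, hσa'⟩ := exists_rank_lt_perm hrank hσ
  suffices ∏ i, M (σ i) i = 0 by rw [this, smul_zero]
  rcases hM a (σ a) (σ.symm a) hσa hσa' with h | h
  · exact Finset.prod_eq_zero (Finset.mem_univ a) h
  · exact Finset.prod_eq_zero (Finset.mem_univ (σ.symm a)) (by rwa [σ.apply_symm_apply])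

/-- The place of a particle in the interlacing order `x₁ ≤ y₁ < x₂ ≤ y₂ < ⋯`. -/
def interlacingRank : Particle N → ℕ
  | .inl i => 2 * i + 1
  | .inr i => 2 * i

theorem interlacingRank_injective : Function.Injective (interlacingRank (N := N)) := by
  rintro (i | i) (j | j) h <;> simp only [interlacingRank] at h
  · exact congrArg _ (Fin.ext (by omega))
  · omega
  · omega
  · exact congrArg _ (Fin.ext (by omega))

namespace State

theorem x_strictMono (z : State N) : StrictMono z.x :=
  Fin.strictMono_iff_lt_succ.2 fun i => (z.interlaces i).1.trans_lt (z.interlaces i).2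

theorem x_le_y (z : State N) {i : Fin (N + 1)} {k : Fin N} (h : (i : ℕ) ≤ k) : z.x i ≤ z.y k :=
  (z.x_strictMono.monotone (Fin.le_def.2 h : i ≤ k.castSucc)).trans (z.interlaces k).1

theorem y_lt_x (z : State N) {i : Fin (N + 1)} {k : Fin N} (h : (k : ℕ) < i) : z.y k < z.x i :=
  (z.interlaces k).2.trans_le (z.x_strictMono.monotone (Fin.le_def.2 h : k.succ ≤ i))

theorem y_strictMono (z : State N) : StrictMono z.y := fun _ k h =>
  (z.y_lt_x (i := k.castSucc) h).trans_le (z.x_le_y le_rfl)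

theorem pos_injective : Function.Injective (pos (N := N)) := fun _ _ h =>
  State.ext (funext fun i => congrFun h (.inl i)) (funext fun i => congrFun h (.inr i))

end State

section EntryZero

variable {lam} {z' : State N} {i : Fin (N + 1)} {k : Fin N} {u : ℕ}

theorem entry_zero_inr_inr {j : Fin (N + 1)} :
    entry lam 0 z' (.inr i) (.inr j) u = if u = z'.x j then 1 else 0 := by
  simp [entry, columnFun, staircase, expSemigroup_zero, bddIndicator_apply, Set.indicator_apply]

theorem entry_zero_inl_inl (hlam : ∀ u, lam u ≠ 0) {j : Fin N} :
    entry lam 0 z' (.inl k) (.inl j) u = if u = z'.y j then 1 else 0 := by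
  simp [entry, columnFun, expSemigroup_zero, birthOperator_bddIndicator_Iic, hlam,
    bddIndicator_apply, Set.indicator_apply]

theorem entry_zero_inr_inl_eq_zero (h : u ≤ z'.y k ↔ (i : ℕ) ≤ k) :
    entry lam 0 z' (.inr i) (.inl k) u = 0 := by
  simp [entry, columnFun, staircase, expSemigroup_zero, bddIndicator_apply, Set.indicator_apply, h]

theorem entry_zero_inl_inr_eq_zero (h : u ≠ z'.x i) (h' : u + 1 ≠ z'.x i) :
    entry lam 0 z' (.inl k) (.inr i) u = 0 := by
  simp [entry, columnFun, expSemigroup_zero, birthOperator_apply, bddIndicator_apply, h, h']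

end EntryZero

section InterlacingRank

variable {lam} {z z' : State N} {b c : Particle N}

theorem particleMatrix_zero_row_inr {i : Fin (N + 1)} (h : z.x i ≤ z'.x i)
    (hc : interlacingRank (.inr i) < interlacingRank c) :
    particleMatrix lam 0 z' z.pos (.inr i) c = 0 := by
  rcases c with j | j <;> simp only [interlacingRank] at hc
  · have hij : (i : ℕ) ≤ j := by omega
    exact entry_zero_inr_inl_eq_zero (iff_of_true (h.trans (z'.x_le_y hij)) hij)
  · have hij : i < j := Fin.lt_def.2 (by omega)
    exact entry_zero_inr_inr.trans (if_neg (h.trans_lt (z'.x_strictMono hij)).ne)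

theorem particleMatrix_zero_col_inr {i : Fin (N + 1)} (h : z'.x i < z.x i)
    (hb : interlacingRank (.inr i) < interlacingRank b) :
    particleMatrix lam 0 z' z.pos b (.inr i) = 0 := by
  rcases b with j | j <;> simp only [interlacingRank] at hb
  · have hlt : z'.x i < z.y j := h.trans_le (z.x_le_y (by omega))
    exact entry_zero_inl_inr_eq_zero (k := j) hlt.ne' (hlt.trans (z.y j).lt_succ_self).ne'
  · have hij : i < j := Fin.lt_def.2 (by omega)
    exact entry_zero_inr_inr.trans (if_neg (h.trans (z.x_strictMono hij)).ne')

theorem particleMatrix_zero_row_inl (hlam : ∀ u, lam u ≠ 0) {k : Fin N} (h : z.y k < z'.y k)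
    (hc : interlacingRank (.inl k) < interlacingRank c) :
    particleMatrix lam 0 z' z.pos (.inl k) c = 0 := by
  rcases c with j | j <;> simp only [interlacingRank] at hc
  · have hkj : k < j := Fin.lt_def.2 (by omega)
    exact (entry_zero_inl_inl hlam (k := k)).trans (if_neg (h.trans (z'.y_strictMono hkj)).ne)
  · have hlt : z.y k + 1 < z'.x j := (Nat.succ_le_of_lt h).trans_lt (z'.y_lt_x (by omega))
    exact entry_zero_inl_inr_eq_zero (k := k) ((z.y k).lt_succ_self.trans hlt).ne hlt.ne

theorem particleMatrix_zero_col_inl (hlam : ∀ u, lam u ≠ 0) {k : Fin N} (h : z'.y k ≤ z.y k)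
    (hb : interlacingRank (.inl k) < interlacingRank b) :
    particleMatrix lam 0 z' z.pos b (.inl k) = 0 := by
  rcases b with j | j <;> simp only [interlacingRank] at hb
  · have hkj : k < j := Fin.lt_def.2 (by omega)
    exact (entry_zero_inl_inl hlam (k := j)).trans (if_neg (h.trans_lt (z.y_strictMono hkj)).ne')
  · have hkj : (k : ℕ) < j := by omega
    exact entry_zero_inr_inl_eq_zero
      (iff_of_false (h.trans_lt (z.y_lt_x hkj)).not_ge hkj.not_ge)

/-- The first particle, in the interlacing order, moved by a permutation that contributes to the
determinant would sit in `z` to the right of its position in `z'` because of its row and to the left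
because of its column, one of the two strictly. -/
theorem particleMatrix_zero_col_or_row (hlam : ∀ u, lam u ≠ 0) {a : Particle N}
    (hb : interlacingRank a < interlacingRank b) (hc : interlacingRank a < interlacingRank c) :
    particleMatrix lam 0 z' z.pos b a = 0 ∨ particleMatrix lam 0 z' z.pos a c = 0 := by
  rcases a with k | i
  · rcases le_or_gt (z'.y k) (z.y k) with h | h
    · exact .inl (particleMatrix_zero_col_inl hlam h hb)
    · exact .inr (particleMatrix_zero_row_inl hlam h hc)
  · rcases lt_or_ge (z'.x i) (z.x i) with h | h
    · exact .inl (particleMatrix_zero_col_inr h hb)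
    · exact .inr (particleMatrix_zero_row_inr h hc)

end InterlacingRank

theorem kernelU_zero (hlam : ∀ u, lam u ≠ 0) (z z' : State N) :
    kernelU lam 0 z z' = ∏ a, if z.pos a = z'.pos a then 1 else 0 := by
  rw [kernelU_eq_det_particleMatrix lam hlam, det_eq_prod_diag_of_rank interlacingRank_injective
    fun _ _ _ => particleMatrix_zero_col_or_row hlam]
  refine Finset.prod_congr rfl ?_
  rintro (i | i) -
  · exact entry_zero_inl_inl hlam (k := i)
  · exact entry_zero_inr_inr (i := i)

theorem kernelU_zero_self (hlam : ∀ u, lam u ≠ 0) (z : State N) : kernelU lam 0 z z = 1 := by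
  simp [kernelU_zero lam hlam]

theorem kernelU_zero_of_ne (hlam : ∀ u, lam u ≠ 0) {z z' : State N} (h : z ≠ z') :
    kernelU lam 0 z z' = 0 := by
  obtain ⟨a, ha⟩ := Function.ne_iff.1 (State.pos_injective.ne h)
  rw [kernelU_zero lam hlam]
  exact Finset.prod_eq_zero (Finset.mem_univ a) (if_neg ha)

end Kernel

/-! ### The renewal equation -/

section Renewal

variable {S ι : Type*} [Fintype ι]

/-- The total rate of the clocks in state `z`, where `rate z a` is the rate of clock `a`. -/
def totalRate (rate : S → ι → ℝ) (z : S) : ℝ := ∑ a, rate z a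

/-- The gain part `f ↦ ∑ₐ rate z a * f (next z a)` of the generator of the chain on `S` that jumps
from `z` to `next z a`, or is killed if this is `none`, when clock `a` rings. -/
def gain (rate : S → ι → ℝ) (next : S → ι → Option S) : (S → ℝ) →ₗ[ℝ] (S → ℝ) where
  toFun f z := ∑ a, rate z a * (next z a).elim 0 f
  map_add' f g := by
    funext z
    rw [Pi.add_apply, ← Finset.sum_add_distrib]
    refine Finset.sum_congr rfl fun a _ => ?_
    cases next z a <;> simp [mul_add]
  map_smul' c f := by
    funext z
    rw [Pi.smul_apply, Finset.smul_sum]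
    refine Finset.sum_congr rfl fun a _ => ?_
    cases next z a <;> simp [mul_left_comm]

theorem gain_apply (rate : S → ι → ℝ) (next : S → ι → Option S) (f : S → ℝ) (z : S) :
    gain rate next f z = ∑ a, rate z a * (next z a).elim 0 f := rfl

theorem gain_nonneg {rate : S → ι → ℝ} (hrate : ∀ z a, 0 ≤ rate z a) (next : S → ι → Option S)
    {f : S → ℝ} (hf : ∀ w, 0 ≤ f w) (z : S) : 0 ≤ gain rate next f z := by
  refine Finset.sum_nonneg fun a _ => mul_nonneg (hrate z a) ?_
  cases next z a
  exacts [le_rfl, hf _]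

theorem abs_gain_le {rate : S → ι → ℝ} (hrate : ∀ z a, 0 ≤ rate z a) (next : S → ι → Option S)
    {f : S → ℝ} {K : ℝ} (hf : ∀ w, |f w| ≤ K) (z : S) :
    |gain rate next f z| ≤ totalRate rate z * K := by
  have hK : 0 ≤ K := (abs_nonneg _).trans (hf z)
  rw [totalRate, Finset.sum_mul]
  refine (Finset.abs_sum_le_sum_abs _ _).trans (Finset.sum_le_sum fun a _ => ?_)
  rw [abs_mul, abs_of_nonneg (hrate z a)]
  refine mul_le_mul_of_nonneg_left ?_ (hrate z a)
  cases next z a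
  exacts [by simpa using hK, hf _]

/-- The integrand of the renewal equation: the density of the time `r` of the first ring, times the
mean value of `V` at the remaining time `s - r` and at the state after this ring. -/
def renewalIntegrand (rate : S → ι → ℝ) (next : S → ι → Option S) (V : S → ℝ → ℝ) (z : S)
    (s r : ℝ) : ℝ :=
  Real.exp (-(totalRate rate z * r)) * gain rate next (fun w => V w (s - r)) z

/-- The renewal equation at the first ring, for a function `V` of the initial state and of time. It
is the integrated form of the backward equation `∂ₛ V = gain V - totalRate * V`. -/
structure IsRenewal (rate : S → ι → ℝ) (next : S → ι → Option S) (V : S → ℝ → ℝ) : Prop where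
  intervalIntegrable (z : S) {s : ℝ} (hs : 0 ≤ s) :
    IntervalIntegrable (renewalIntegrand rate next V z s) volume 0 s
  eq_add_integral (z : S) {s : ℝ} (hs : 0 ≤ s) :
    V z s = Real.exp (-(totalRate rate z * s)) * V z 0 +
      ∫ r in 0..s, renewalIntegrand rate next V z s r

variable {rate : S → ι → ℝ} {next : S → ι → Option S} {V W : S → ℝ → ℝ}

theorem isRenewal_of_hasDerivAt (h : ∀ z s, HasDerivAt (V z)
      (gain rate next (fun w => V w s) z - totalRate rate z * V z s) s) :
    IsRenewal rate next V := by
  have hV (z : S) : Continuous (V z) :=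
    continuous_iff_continuousAt.2 fun s => (h z s).continuousAt
  have hcont (z : S) (s : ℝ) : Continuous (renewalIntegrand rate next V z s) := by
    refine .mul (by fun_prop) (continuous_finsetSum _ fun a _ => continuous_const.mul ?_)
    cases next z a
    exacts [continuous_const, (hV _).comp (by fun_prop)]
  refine ⟨fun z s _ => (hcont z s).intervalIntegrable _ _, fun z s _ => ?_⟩
  have hderiv (r : ℝ) : HasDerivAt (fun r => -(Real.exp (-(totalRate rate z * r)) * V z (s - r)))
      (renewalIntegrand rate next V z s r) r := by
    have hexp : HasDerivAt (fun r => Real.exp (-(totalRate rate z * r)))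
        (-(totalRate rate z * Real.exp (-(totalRate rate z * r)))) r := by
      simpa using (hasDerivAt_neg_exp_mul_exp (r := totalRate rate z) (x := r)).fun_neg
    refine (hexp.mul (HasDerivAt.comp_const_sub s r (h z (s - r)))).neg.congr_deriv ?_
    rw [renewalIntegrand]
    ring
  rw [intervalIntegral.integral_eq_sub_of_hasDerivAt (fun r _ => hderiv r)
    ((hcont z s).intervalIntegrable _ _)]
  simp

theorem isRenewal_of_lintegral (hrate : ∀ z a, 0 ≤ rate z a) (hVm : ∀ z, Measurable (V z))
    (hV : ∀ z s, 0 ≤ V z s) (h : ∀ z, ∀ s ≥ 0, ENNReal.ofReal (V z s) =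
      ENNReal.ofReal (Real.exp (-(totalRate rate z * s)) * V z 0) +
        ∫⁻ r in Set.Ioc 0 s, ENNReal.ofReal (renewalIntegrand rate next V z s r)) :
    IsRenewal rate next V := by
  have hnonneg (z : S) (s r : ℝ) : 0 ≤ renewalIntegrand rate next V z s r :=
    mul_nonneg (Real.exp_pos _).le (gain_nonneg hrate next (fun w => hV w _) z)
  have hmeas (z : S) (s : ℝ) : Measurable (renewalIntegrand rate next V z s) := by
    refine .mul (by fun_prop) (Finset.measurable_sum _ fun a _ => measurable_const.mul ?_)
    cases next z a
    exacts [measurable_const, (hVm _).comp (by fun_prop)]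
  have hint (z : S) {s : ℝ} (hs : 0 ≤ s) :
      IntegrableOn (renewalIntegrand rate next V z s) (Set.Ioc 0 s) := by
    refine ⟨(hmeas z s).aestronglyMeasurable, ?_⟩
    rw [hasFiniteIntegral_iff_ofReal (.of_forall (hnonneg z s))]
    exact (le_add_self.trans (h z s hs).ge).trans_lt ENNReal.ofReal_lt_top
  refine ⟨fun z s hs => (intervalIntegrable_iff_integrableOn_Ioc_of_le hs).2 (hint z hs),
    fun z s hs => ?_⟩
  have hVs := h z s hs
  have hexp : 0 ≤ Real.exp (-(totalRate rate z * s)) * V z 0 :=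
    mul_nonneg (Real.exp_pos _).le (hV z 0)
  have hI := intervalIntegral.integral_nonneg (μ := volume) hs fun r _ => hnonneg z s r
  rw [← ofReal_integral_eq_lintegral_ofReal (hint z hs) (.of_forall (hnonneg z s)),
    ← intervalIntegral.integral_of_le hs, ← ENNReal.ofReal_add hexp hI] at hVs
  exact (ENNReal.ofReal_eq_ofReal_iff (hV z s) (add_nonneg hexp hI)).1 hVs

namespace IsRenewal

theorem sub (hV : IsRenewal rate next V) (hW : IsRenewal rate next W) :
    IsRenewal rate next (V - W) := by
  have hsub (z : S) (s : ℝ) : renewalIntegrand rate next (V - W) z s =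
      renewalIntegrand rate next V z s - renewalIntegrand rate next W z s := by
    funext r
    simp only [renewalIntegrand, Pi.sub_apply]
    rw [← mul_sub, ← Pi.sub_apply (gain rate next _), ← map_sub]
    rfl
  refine ⟨fun z s hs => ?_, fun z s hs => ?_⟩
  · rw [hsub]
    exact (hV.intervalIntegrable z hs).sub (hW.intervalIntegrable z hs)
  · simp only [hsub, Pi.sub_apply]
    rw [intervalIntegral.integral_sub (hV.intervalIntegrable z hs) (hW.intervalIntegrable z hs),
      hV.eq_add_integral z hs, hW.eq_add_integral z hs]
    ring

theorem smul (hV : IsRenewal rate next V) (c : ℝ) : IsRenewal rate next (c • V) := by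
  have hsmul (z : S) (s : ℝ) : renewalIntegrand rate next (c • V) z s =
      c • renewalIntegrand rate next V z s := by
    funext r
    simp only [renewalIntegrand, Pi.smul_apply]
    rw [← mul_smul_comm, ← Pi.smul_apply c (gain rate next _), ← map_smul]
    rfl
  refine ⟨fun z s hs => ?_, fun z s hs => ?_⟩
  · rw [hsmul]
    exact (hV.intervalIntegrable z hs).smul c
  · simp only [hsmul, Pi.smul_apply]
    rw [intervalIntegral.integral_smul, hV.eq_add_integral z hs, smul_add, mul_smul_comm]

theorem abs_le_of_abs_le (hrate : ∀ z a, 0 ≤ rate z a) (hV : IsRenewal rate next V)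
    (h0 : ∀ z, V z 0 = 0) {C T K : ℝ} (hC : ∀ z, totalRate rate z ≤ C)
    (hK : ∀ z, ∀ s ∈ Set.Icc 0 T, |V z s| ≤ K) (z : S) {s : ℝ} (hs : s ∈ Set.Icc 0 T) :
    |V z s| ≤ (1 - Real.exp (-(C * T))) * K := by
  set c := totalRate rate z
  have hc : 0 ≤ c := Finset.sum_nonneg fun a _ => hrate z a
  have hK0 : 0 ≤ K := (abs_nonneg _).trans (hK z s hs)
  have hbound (r : ℝ) (hr : r ∈ Set.Ioc 0 s) :
      ‖renewalIntegrand rate next V z s r‖ ≤ c * Real.exp (-(c * r)) * K := by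
    have hgain := abs_gain_le hrate next (f := fun w => V w (s - r)) (K := K) ?_ z
    · rw [renewalIntegrand, norm_mul, Real.norm_eq_abs, Real.norm_eq_abs, Real.abs_exp]
      calc _ ≤ Real.exp (-(c * r)) * (c * K) := by gcongr
        _ = c * Real.exp (-(c * r)) * K := by ring
    · exact fun w => hK w _ ⟨by linarith [hr.2], by linarith [hr.1, hs.2]⟩
  have hexp : ∫ r in 0..s, c * Real.exp (-(c * r)) = 1 - Real.exp (-(c * s)) := by
    rw [intervalIntegral.integral_eq_sub_of_hasDerivAt
      (fun r _ => hasDerivAt_neg_exp_mul_exp (r := c))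
      (Continuous.intervalIntegrable (by fun_prop) _ _)]
    simp only [mul_zero, neg_zero, Real.exp_zero, sub_neg_eq_add]
    ring
  calc |V z s| = ‖∫ r in 0..s, renewalIntegrand rate next V z s r‖ := by
        rw [hV.eq_add_integral z hs.1, h0, mul_zero, zero_add, Real.norm_eq_abs]
    _ ≤ ∫ r in 0..s, c * Real.exp (-(c * r)) * K :=
        intervalIntegral.norm_integral_le_of_norm_le hs.1 (.of_forall hbound)
          (Continuous.intervalIntegrable (by fun_prop) _ _)
    _ = (1 - Real.exp (-(c * s))) * K := by rw [intervalIntegral.integral_mul_const, hexp]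
    _ ≤ (1 - Real.exp (-(C * T))) * K := by
        have := mul_le_mul (hC z) hs.2 hs.1 (hc.trans (hC z))
        gcongr

theorem eq_zero (hrate : ∀ z a, 0 ≤ rate z a) (hV : IsRenewal rate next V)
    (h0 : ∀ z, V z 0 = 0) {C : ℝ} (hC : ∀ z, totalRate rate z ≤ C)
    {s K : ℝ} (hK : ∀ z, ∀ r ∈ Set.Icc 0 s, |V z r| ≤ K) (hs : 0 ≤ s) (z : S) :
    V z s = 0 := by
  have hC0 : 0 ≤ C := (Finset.sum_nonneg fun a _ => hrate z a).trans (hC z)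
  set q := 1 - Real.exp (-(C * s))
  have hq0 : 0 ≤ q := sub_nonneg.2 (Real.exp_le_one_iff.2 (neg_nonpos.2 (mul_nonneg hC0 hs)))
  have hq1 : q < 1 := sub_lt_self _ (Real.exp_pos _)
  have hiter (m : ℕ) : ∀ z, ∀ r ∈ Set.Icc 0 s, |V z r| ≤ q ^ m * K := by
    induction m with
    | zero => simpa using hK
    | succ m ih =>
      intro z r hr
      rw [pow_succ', mul_assoc]
      exact abs_le_of_abs_le hrate hV h0 hC ih z hr
  have hlim : Filter.Tendsto (fun m : ℕ => q ^ m * K) Filter.atTop (𝓝 0) := by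
    simpa using (tendsto_pow_atTop_nhds_zero_of_lt_one hq0 hq1).mul_const K
  exact abs_nonpos_iff.1 (ge_of_tendsto' hlim fun m => hiter m z s ⟨hs, le_rfl⟩)

end IsRenewal

end Renewal

/-! ### Competing exponential clocks -/

theorem lintegral_expMeasure {r : ℝ} {f : ℝ → ℝ≥0∞} (hf : Measurable f) :
    ∫⁻ x, f x ∂expMeasure r = ∫⁻ x in Set.Ioi 0, .ofReal (r * Real.exp (-(r * x))) * f x := by
  have hpdf : Measurable (exponentialPDF r) := (measurable_exponentialPDFReal r).ennreal_ofReal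
  refine (lintegral_withDensity_eq_lintegral_mul _ hpdf hf).trans ?_
  rw [setLIntegral_congr Ioi_ae_eq_Ici, ← lintegral_indicator measurableSet_Ici]
  refine lintegral_congr fun x => ?_
  rcases le_or_gt 0 x with hx | hx
  · rw [Set.indicator_of_mem (Set.mem_Ici.2 hx), Pi.mul_apply, ← exponentialPDF_of_nonneg hx]
  · rw [Set.indicator_of_notMem (Set.notMem_Ici.2 hx), Pi.mul_apply]
    exact mul_eq_zero_of_left (exponentialPDF_of_neg hx) _

theorem expMeasure_Ioi {r : ℝ} (hr : 0 < r) {u : ℝ} (hu : 0 ≤ u) :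
    expMeasure r (Set.Ioi u) = .ofReal (Real.exp (-(r * u))) := by
  have := isProbabilityMeasure_expMeasure hr
  rw [← ofReal_measureReal, ← Set.compl_Iic, probReal_compl_eq_one_sub measurableSet_Iic,
    ← cdf_eq_real, cdf_expMeasure_eq hr, if_pos hu, sub_sub_cancel]

theorem ae_pos_expMeasure {r : ℝ} (hr : 0 < r) : ∀ᵐ x ∂expMeasure r, 0 < x := by
  have := isProbabilityMeasure_expMeasure hr
  exact (mem_ae_iff_prob_eq_one measurableSet_Ioi).2 ((expMeasure_Ioi hr le_rfl).trans (by simp))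

theorem map_div_expMeasure_one {r : ℝ} (hr : 0 < r) :
    (expMeasure 1).map (· / r) = expMeasure r := by
  have := isProbabilityMeasure_expMeasure one_pos
  have := isProbabilityMeasure_expMeasure hr
  have hdiv : Measurable (· / r : ℝ → ℝ) := measurable_id.div_const r
  have := Measure.isProbabilityMeasure_map (μ := expMeasure 1) hdiv.aemeasurable
  refine Measure.eq_of_cdf _ _ (StieltjesFunction.ext fun x => ?_)
  have hpre : (· / r) ⁻¹' Set.Iic x = Set.Iic (r * x) := by
    ext y
    simp [div_le_iff₀' hr]
  rw [cdf_eq_real, map_measureReal_apply hdiv measurableSet_Iic, hpre, ← cdf_eq_real,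
    cdf_expMeasure_eq one_pos, cdf_expMeasure_eq hr, one_mul]
  simp only [mul_nonneg_iff_of_pos_left hr]

section FirstRing

variable {ι : Type*}

theorem measurableSet_forall_ne_lt [Finite ι] (a : ι) :
    MeasurableSet {x : ι → ℝ | ∀ b ≠ a, x a < x b} := by
  simp only [Set.ofPred_forall]
  exact .iInter fun b => .iInter fun _ => measurableSet_lt (by fun_prop) (by fun_prop)

variable [Fintype ι]

theorem lintegral_pi_indicator_forall_ne_lt [DecidableEq ι] (μ : ι → Measure ℝ)
    [∀ a, SigmaFinite (μ a)] (a : ι) {F : ℝ → ℝ≥0∞} (hF : Measurable F) :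
    ∫⁻ x, {x : ι → ℝ | ∀ b ≠ a, x a < x b}.indicator (fun x => F (x a)) x ∂Measure.pi μ =
      ∫⁻ u, F u * ∏ b ∈ Finset.univ.erase a, μ b (Set.Ioi u) ∂μ a := by
  have hmeas : Measurable
      ({x : ι → ℝ | ∀ b ≠ a, x a < x b}.indicator fun x => F (x a)) :=
    .indicator (by fun_prop) (measurableSet_forall_ne_lt a)
  rw [lintegral_eq_lmarginal_univ 0, lmarginal_erase _ hmeas (Finset.mem_univ a)]
  refine lintegral_congr fun u => ?_
  have hpi (y : Finset.univ.erase a → ℝ) :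
      {x : ι → ℝ | ∀ b ≠ a, x a < x b}.indicator (fun x => F (x a))
          (Function.updateFinset (Function.update 0 a u) (Finset.univ.erase a) y) =
        (Set.univ.pi fun _ => Set.Ioi u).indicator (fun _ => F u) y := by
    refine Set.indicator_eq_indicator ?_ (by simp [Function.updateFinset])
    simp +contextual [Function.updateFinset, Set.mem_pi]
  simp only [lmarginal, hpi]
  rw [lintegral_indicator_const (.univ_pi fun _ => measurableSet_Ioi), Measure.pi_pi,
    Finset.prod_coe_sort (Finset.univ.erase a) fun b => μ b (Set.Ioi u)]

variable {c : ι → ℝ}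

theorem lintegral_pi_expMeasure_indicator_forall_ne_lt (hc : ∀ a, 0 < c a) (a : ι)
    {F : ℝ → ℝ≥0∞} (hF : Measurable F) :
    ∫⁻ x, {x : ι → ℝ | ∀ b ≠ a, x a < x b}.indicator (fun x => F (x a)) x
        ∂Measure.pi (fun a => expMeasure (c a)) =
      ∫⁻ r in Set.Ioi 0, .ofReal (Real.exp (-((∑ b, c b) * r))) * (.ofReal (c a) * F r) := by
  classical
  have (b : ι) := isProbabilityMeasure_expMeasure (hc b)
  have hprod : Measurable fun u => ∏ b ∈ Finset.univ.erase a, expMeasure (c b) (Set.Ioi u) :=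
    Finset.measurable_prod _ fun b _ =>
      Antitone.measurable fun u v huv => measure_mono (Set.Ioi_subset_Ioi huv)
  rw [lintegral_pi_indicator_forall_ne_lt _ a hF, lintegral_expMeasure (hF.fun_mul hprod)]
  refine setLIntegral_congr_fun measurableSet_Ioi fun r hr => ?_
  simp only [expMeasure_Ioi (hc _) (Set.mem_Ioi.1 hr).le]
  rw [← ENNReal.ofReal_prod_of_nonneg fun b _ => (Real.exp_pos _).le, ← Real.exp_sum,
    ENNReal.ofReal_mul (hc a).le, Finset.sum_mul, ← Finset.sum_neg_distrib,
    ← Finset.add_sum_erase _ _ (Finset.mem_univ a), Real.exp_add,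
    ENNReal.ofReal_mul (Real.exp_pos _).le]
  ring

theorem ae_exists_forall_ne_lt [Nonempty ι] (hc : ∀ a, 0 < c a) :
    ∀ᵐ x ∂Measure.pi (fun a => expMeasure (c a)), ∃ a, ∀ b ≠ a, x a < x b := by
  have (b : ι) := isProbabilityMeasure_expMeasure (hc b)
  have hC : 0 < ∑ b, c b := Finset.sum_pos (fun a _ => hc a) Finset.univ_nonempty
  have := isProbabilityMeasure_expMeasure hC
  suffices h : Measure.pi (fun a => expMeasure (c a)) (⋃ a, {x | ∀ b ≠ a, x a < x b}) = 1 by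
    filter_upwards [(mem_ae_iff_prob_eq_one (.iUnion measurableSet_forall_ne_lt)).2 h] with x hx
    exact Set.mem_iUnion.1 hx
  have hdisj : Pairwise (Function.onFun Disjoint fun a => {x : ι → ℝ | ∀ b ≠ a, x a < x b}) :=
    fun a b hab => Set.disjoint_left.2 fun x ha hb => lt_asymm (ha b hab.symm) (hb a hab)
  have hset (a : ι) : Measure.pi (fun a => expMeasure (c a)) {x | ∀ b ≠ a, x a < x b} =
      ∫⁻ r in Set.Ioi 0, .ofReal (Real.exp (-((∑ b, c b) * r))) * .ofReal (c a) := by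
    have h := lintegral_pi_expMeasure_indicator_forall_ne_lt hc a (F := fun _ => 1) measurable_const
    rw [lintegral_indicator_const (measurableSet_forall_ne_lt a), one_mul] at h
    simpa only [mul_one] using h
  rw [measure_iUnion hdisj measurableSet_forall_ne_lt, tsum_fintype, Finset.sum_congr rfl
    fun a _ => hset a, ← lintegral_finsetSum _ fun a _ => by fun_prop,
    ← measure_univ (μ := expMeasure (∑ b, c b)), ← lintegral_one,
    lintegral_expMeasure measurable_const]
  refine lintegral_congr fun r => ?_
  rw [← Finset.mul_sum, ← ENNReal.ofReal_sum_of_nonneg fun a _ => (hc a).le, mul_one, mul_comm,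
    ENNReal.ofReal_mul hC.le]

variable [Nonempty ι]

/-- The index of a smallest value, chosen as in `firstRing`. -/
def argmin (x : ι → ℝ) : ι := (Finite.exists_min x).choose

theorem argmin_le (x : ι → ℝ) (a : ι) : x (argmin x) ≤ x a :=
  (Finite.exists_min x).choose_spec a

theorem argmin_eq_of_forall_ne_lt {x : ι → ℝ} {a : ι} (h : ∀ b ≠ a, x a < x b) : argmin x = a :=
  not_not.1 fun hne => (argmin_le x a).not_gt (h _ hne)

theorem measurable_argmin [MeasurableSpace ι] [DiscreteMeasurableSpace ι] :
    Measurable (argmin (ι := ι)) := by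
  let H (p : ι → Prop) : ι :=
    open Classical in if h : ∃ a, p a then h.choose else Classical.ofNonempty
  have hH : argmin = H ∘ fun x a => ∀ b, x a ≤ x b := funext fun x => (dif_pos _).symm
  rw [hH]
  refine (measurable_of_finite H).comp (measurable_pi_iff.2 fun a => measurableSet_setOfPred.1 ?_)
  rw [Set.ofPred_forall]
  exact .iInter fun b => measurableSet_le (by fun_prop) (by fun_prop)

theorem measurable_apply_argmin {β : Type*} [MeasurableSpace β] {F : ι → ℝ → β}
    (hF : ∀ a, Measurable (F a)) : Measurable fun x => F (argmin x) (x (argmin x)) := by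
  let : MeasurableSpace ι := ⊤
  have hpair : Measurable fun p : (ι → ℝ) × ι => F p.2 (p.1 p.2) :=
    measurable_from_prod_countable_left fun a => (hF a).comp (measurable_pi_apply a)
  exact hpair.comp (measurable_id.prodMk measurable_argmin)

theorem lintegral_argmin_pi_expMeasure (hc : ∀ a, 0 < c a) {F : ι → ℝ → ℝ≥0∞}
    (hF : ∀ a, Measurable (F a)) :
    ∫⁻ x, F (argmin x) (x (argmin x)) ∂Measure.pi (fun a => expMeasure (c a)) =
      ∫⁻ r in Set.Ioi 0, .ofReal (Real.exp (-((∑ b, c b) * r))) * ∑ a, .ofReal (c a) * F a r := by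
  simp only [Finset.mul_sum]
  rw [lintegral_finsetSum _ fun a _ => by fun_prop]
  simp only [← lintegral_pi_expMeasure_indicator_forall_ne_lt hc _ (hF _)]
  rw [← lintegral_finsetSum _ fun a _ =>
    Measurable.indicator (by fun_prop) (measurableSet_forall_ne_lt a)]
  refine lintegral_congr_ae ?_
  filter_upwards [ae_exists_forall_ne_lt hc] with x ⟨a, ha⟩
  rw [Finset.sum_eq_single a _ (by simp), argmin_eq_of_forall_ne_lt ha, Set.indicator_of_mem]
  · exact ha
  · refine fun b _ hba => Set.indicator_of_notMem (fun hb : ∀ a ≠ b, x b < x a => ?_) _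
    exact lt_asymm (hb a hba.symm) (ha b hba)

end FirstRing

/-! ### Decomposition of the dynamics at the first ring -/

section Dynamics

variable {lam : ℕ → ℝ} {N : ℕ}

/-- Exactly `n` rings have occurred by time `t`, for the process started from `z` and driven by the
clocks `e`. Once the process is killed no further ring occurs, and this fails for every `n`. -/
def IsRingCount (lam : ℕ → ℝ) (z : State N) (e : ℕ × Particle N → ℝ) (t : ℝ) (n : ℕ) : Prop :=
  (ringChain lam z e n).1 ≤ t ∧ t < (ringChain lam z e (n + 1)).1

theorem process_eq_some_iff {z w : State N} {e : ℕ × Particle N → ℝ} {t : ℝ} :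
    process lam z e t = some w ↔ ∃ n, IsRingCount lam z e t n ∧
      (∀ m < n, ¬IsRingCount lam z e t m) ∧ (ringChain lam z e n).2 = some w := by
  simp only [IsRingCount]
  constructor
  · intro h
    rw [process] at h
    split_ifs at h with hn
    exact ⟨Nat.find hn, Nat.find_spec hn, fun _ => Nat.find_min hn, h⟩
  · rintro ⟨n, hn, hmin, hw⟩
    rw [process, dif_pos ⟨n, hn⟩, (Nat.find_eq_iff _).2 ⟨hn, hmin⟩, hw]

/-- The clocks whose first round is `ε` and whose later rounds are `e`. -/
def consClock (ε : Particle N → ℝ) (e : ℕ × Particle N → ℝ) : ℕ × Particle N → ℝ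
  | (0, a) => ε a
  | (n + 1, a) => e (n, a)

/-- The time of the first ring in state `z`, when the first round of the clocks is `ε`. -/
def firstRingTime (lam : ℕ → ℝ) (z : State N) (ε : Particle N → ℝ) : ℝ :=
  clockTime lam z ε (firstRing lam z ε)

theorem ringChain_consClock_of_none {z : State N} {ε : Particle N → ℝ}
    (h : z.ring (firstRing lam z ε) = none) (e : ℕ × Particle N → ℝ) (n : ℕ) :
    ringChain lam z (consClock ε e) (n + 1) = (firstRingTime lam z ε, none) := by
  induction n with
  | zero => exact Prod.ext (zero_add _) h
  | succ n ih => rw [ringChain, ih]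

theorem ringChain_consClock_of_some {z v : State N} {ε : Particle N → ℝ}
    (h : z.ring (firstRing lam z ε) = some v) (e : ℕ × Particle N → ℝ) (n : ℕ) :
    ringChain lam z (consClock ε e) (n + 1) =
      (firstRingTime lam z ε + (ringChain lam v e n).1, (ringChain lam v e n).2) := by
  induction n with
  | zero => exact Prod.ext (add_comm _ _) h
  | succ n ih =>
    rw [ringChain, ih, ringChain]
    rcases ringChain lam v e n with ⟨s, _ | u⟩
    · rfl
    · simp only [consClock, add_assoc]

theorem isRingCount_consClock_zero (z : State N) (ε : Particle N → ℝ) (e : ℕ × Particle N → ℝ)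
    {t : ℝ} (ht : 0 ≤ t) :
    IsRingCount lam z (consClock ε e) t 0 ↔ t < firstRingTime lam z ε := by
  have h : (ringChain lam z (consClock ε e) 1).1 = firstRingTime lam z ε := zero_add _
  rw [IsRingCount, zero_add, h]
  exact and_iff_right ht

theorem isRingCount_consClock_succ {z v : State N} {ε : Particle N → ℝ}
    (h : z.ring (firstRing lam z ε) = some v) (e : ℕ × Particle N → ℝ) (t : ℝ) (n : ℕ) :
    IsRingCount lam z (consClock ε e) t (n + 1) ↔
      IsRingCount lam v e (t - firstRingTime lam z ε) n := by
  rw [IsRingCount, ringChain_consClock_of_some h, ringChain_consClock_of_some h, IsRingCount,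
    le_sub_iff_add_le', sub_lt_iff_lt_add']

/-- The state at time `t` of the dynamics started from `z`, if the first ring is that of the clock
of `a` at time `r`, and the later rounds of the clocks are `e`. -/
def stepProcess (lam : ℕ → ℝ) (z : State N) (a : Particle N) (r : ℝ)
    (e : ℕ × Particle N → ℝ) (t : ℝ) : Option (State N) :=
  if t < r then some z else (z.ring a).bind fun v => process lam v e (t - r)

theorem process_consClock (z : State N) (ε : Particle N → ℝ) (e : ℕ × Particle N → ℝ) {t : ℝ}
    (ht : 0 ≤ t) :
    process lam z (consClock ε e) t =
      stepProcess lam z (firstRing lam z ε) (firstRingTime lam z ε) e t := by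
  have hzero := isRingCount_consClock_zero (lam := lam) z ε e ht
  rw [stepProcess]
  split_ifs with hlt
  · exact process_eq_some_iff.2 ⟨0, hzero.2 hlt, fun m hm => absurd hm m.not_lt_zero, rfl⟩
  rw [← hzero] at hlt
  rcases h : z.ring (firstRing lam z ε) with _ | v
  · refine Option.eq_none_iff_forall_ne_some.2 fun w hw => ?_
    obtain ⟨_ | n, hn, -, hw⟩ := process_eq_some_iff.1 hw
    · exact hlt hn
    · simp [ringChain_consClock_of_none h] at hw
  · refine Option.ext fun w => ?_
    rw [Option.bind_some, process_eq_some_iff, process_eq_some_iff, ← Nat.or_exists_add_one]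
    simp only [hlt, not_false_eq_true, false_and, false_or, true_and, Nat.forall_lt_succ_left,
      isRingCount_consClock_succ h, ringChain_consClock_of_some h]

/-! ### Measurability of the dynamics -/

instance : DiscreteMeasurableSpace (Particle N) :=
  ⟨fun _ => measurableSet_sum_iff.2 ⟨.of_discrete, .of_discrete⟩⟩

instance : Countable (State N) :=
  Function.Injective.countable (f := fun z : State N => (z.y, z.x)) fun _ _ h =>
    State.ext congr($(h).1) congr($(h).2)

instance : MeasurableSpace (Option (State N)) := ⊤

theorem measurable_clockTime (z : State N) : Measurable (clockTime lam z) :=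
  measurable_pi_iff.2 fun a => (measurable_pi_apply a).div_const _

theorem measurable_apply_firstRing {β : Type*} [MeasurableSpace β] {F : Particle N → ℝ → β}
    (hF : ∀ a, Measurable (F a)) (z : State N) :
    Measurable fun ε => F (firstRing lam z ε) (firstRingTime lam z ε) :=
  (measurable_apply_argmin hF).comp (measurable_clockTime z)

theorem measurable_ringChain (z : State N) (n : ℕ) : Measurable fun e => ringChain lam z e n := by
  induction n with
  | zero => exact measurable_const
  | succ n ih =>
    let G : (ℝ × (Particle N → ℝ)) × Option (State N) → ℝ × Option (State N) := fun p =>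
      p.2.elim (p.1.1, none) fun w =>
        (p.1.1 + firstRingTime lam w p.1.2, w.ring (firstRing lam w p.1.2))
    have hG : Measurable G := by
      refine measurable_from_prod_countable_left fun o => ?_
      rcases o with _ | w
      · exact measurable_fst.prodMk measurable_const
      · have htime := measurable_apply_firstRing (lam := lam) (fun _ => measurable_id) w
        have hring := measurable_apply_firstRing (lam := lam) (F := fun a _ => w.ring a)
          (fun _ => measurable_const) w
        exact (measurable_fst.add (htime.comp measurable_snd)).prodMk (hring.comp measurable_snd)
    have hsucc : (fun e => ringChain lam z e (n + 1)) = fun e =>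
        G (((ringChain lam z e n).1, fun a => e (n, a)), (ringChain lam z e n).2) := by
      funext e
      rw [ringChain]
      rcases ringChain lam z e n with ⟨s, _ | w⟩ <;> rfl
    rw [hsucc]
    exact hG.comp ((ih.fst.prodMk (by fun_prop)).prodMk ih.snd)

theorem measurable_process (z : State N) :
    Measurable fun p : (ℕ × Particle N → ℝ) × ℝ => process lam z p.1 p.2 := by
  have hchain (n : ℕ) : Measurable fun p : (ℕ × Particle N → ℝ) × ℝ => ringChain lam z p.1 n :=
    (measurable_ringChain z n).comp measurable_fst
  have hcount (n : ℕ) : MeasurableSet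
      {p : (ℕ × Particle N → ℝ) × ℝ | IsRingCount lam z p.1 p.2 n} :=
    (measurableSet_le (hchain n).fst measurable_snd).inter
      (measurableSet_lt measurable_snd (hchain (n + 1)).fst)
  have hsome (w : State N) : MeasurableSet
      {p : (ℕ × Particle N → ℝ) × ℝ | process lam z p.1 p.2 = some w} := by
    simp only [process_eq_some_iff, Set.ofPred_exists, Set.ofPred_and, Set.ofPred_forall]
    exact .iUnion fun n => (hcount n).inter <|
      (MeasurableSet.iInter fun m => .iInter fun _ => (hcount m).compl).inter <|
        (hchain n).snd (.singleton _)
  refine measurable_to_countable' fun o => ?_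
  rcases o with _ | w
  · convert (MeasurableSet.iUnion hsome).compl
    ext p
    simp [Option.eq_none_iff_forall_ne_some]
  · exact hsome w

theorem measurable_stepProcess (z : State N) (a : Particle N) (t : ℝ) :
    Measurable fun p : ℝ × (ℕ × Particle N → ℝ) => stepProcess lam z a p.1 p.2 t := by
  refine .ite (measurableSet_lt measurable_const measurable_fst) measurable_const ?_
  rcases z.ring a with _ | v
  · exact measurable_const
  · exact (measurable_process v).comp
      (measurable_snd.prodMk (measurable_const.sub measurable_fst))

theorem map_clockTime (hlam : ∀ x, 0 < lam x) (z : State N) :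
    (Measure.pi fun _ => expMeasure 1).map (clockTime lam z) =
      Measure.pi fun a => expMeasure (lam (z.pos a)) := by
  have := isProbabilityMeasure_expMeasure one_pos
  have hdiv (a : Particle N) : Measurable (· / lam (z.pos a) : ℝ → ℝ) := measurable_id.div_const _
  have (a : Particle N) : SigmaFinite ((expMeasure 1).map (· / lam (z.pos a))) := by
    have := isProbabilityMeasure_expMeasure (hlam (z.pos a))
    rw [map_div_expMeasure_one (hlam _)]
    infer_instance
  simp only [← map_div_expMeasure_one (hlam _)]
  exact Measure.pi_map_pi fun a => (hdiv a).aemeasurable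

/-- The rate of the clock of the particle `a` in state `z`. -/
def clockRate (lam : ℕ → ℝ) (z : State N) (a : Particle N) : ℝ := lam (z.pos a)

theorem generator_eq_gain_sub (f : State N → ℝ) (z : State N) :
    generator lam f z =
      gain (clockRate lam) State.ring f z - totalRate (clockRate lam) z * f z := by
  simp only [generator, mul_sub, Finset.sum_sub_distrib, totalRate, Finset.sum_mul]
  rfl

theorem lintegral_firstRing (hlam : ∀ x, 0 < lam x) (z : State N) {F : Particle N → ℝ → ℝ≥0∞}
    (hF : ∀ a, Measurable (F a)) :
    ∫⁻ ε, F (firstRing lam z ε) (firstRingTime lam z ε) ∂Measure.pi (fun _ => expMeasure 1) =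
      ∫⁻ r in Set.Ioi 0, .ofReal (Real.exp (-(totalRate (clockRate lam) z * r))) *
        ∑ a, .ofReal (clockRate lam z a) * F a r := by
  refine Eq.trans ?_ (lintegral_argmin_pi_expMeasure (fun a => hlam (z.pos a)) hF)
  rw [← map_clockTime hlam z, lintegral_map (measurable_apply_argmin hF) (measurable_clockTime z)]
  rfl

/-! ### The law of the clocks -/

/-- The law of the clocks: independent standard exponential variables. -/
def clockLaw (N : ℕ) : Measure (ℕ × Particle N → ℝ) :=
  Measure.infinitePi fun _ => expMeasure 1

instance : IsProbabilityMeasure (clockLaw N) := by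
  have := isProbabilityMeasure_expMeasure one_pos
  unfold clockLaw
  infer_instance

theorem map_eq_clockLaw {Ω : Type*} [MeasurableSpace Ω] {P : Measure Ω} [IsProbabilityMeasure P]
    {e : ℕ × Particle N → Ω → ℝ} (hm : ∀ p, Measurable (e p))
    (hlaw : ∀ p, P.map (e p) = expMeasure 1) (hind : iIndepFun e P) :
    P.map (fun ω p => e p ω) = clockLaw N := by
  rw [(iIndepFun_iff_map_fun_eq_infinitePi_map hm).1 hind, clockLaw]
  simp only [hlaw]

theorem measurable_consClock :
    Measurable fun q : (Particle N → ℝ) × (ℕ × Particle N → ℝ) => consClock q.1 q.2 := by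
  refine measurable_pi_iff.2 ?_
  rintro ⟨_ | n, a⟩
  · exact (measurable_pi_apply a).comp measurable_fst
  · exact (measurable_pi_apply (n, a)).comp measurable_snd

theorem map_consClock : ((Measure.pi fun _ : Particle N => expMeasure 1).prod (clockLaw N)).map
    (fun q => consClock q.1 q.2) = clockLaw N := by
  classical
  have := isProbabilityMeasure_expMeasure one_pos
  refine Measure.eq_infinitePi _ fun s t ht => ?_
  rw [Measure.map_apply measurable_consClock (.pi s.countable_toSet fun i _ => ht i)]
  have hfirst : Function.Injective fun a : Particle N => ((0 : ℕ), a) := Prod.mk_right_injective 0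
  have hlater : Function.Injective fun p : ℕ × Particle N => (p.1 + 1, p.2) :=
    Nat.succ_injective.prodMap Function.injective_id
  have hset : (fun q : (Particle N → ℝ) × (ℕ × Particle N → ℝ) => consClock q.1 q.2) ⁻¹'
      Set.pi s t =
      (Set.pi (s.preimage _ hfirst.injOn : Finset (Particle N)) fun a => t (0, a)) ×ˢ
        (Set.pi (s.preimage _ hlater.injOn : Finset (ℕ × Particle N))
          fun p => t (p.1 + 1, p.2)) := by
    ext q
    simp only [Set.mem_preimage, Set.mem_pi, Set.mem_prod, Finset.mem_coe, Finset.mem_preimage]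
    refine ⟨fun h => ⟨fun a => h (0, a), fun p => h (p.1 + 1, p.2)⟩, ?_⟩
    rintro ⟨h0, h1⟩ ⟨_ | n, a⟩
    exacts [h0 a, h1 (n, a)]
  rw [hset, Measure.prod_prod, ← Measure.infinitePi_eq_pi, clockLaw,
    Measure.infinitePi_pi _ fun i _ => ht _, Measure.infinitePi_pi _ fun i _ => ht _,
    Finset.prod_preimage' _ _ hfirst.injOn fun p => expMeasure 1 (t p),
    Finset.prod_preimage' _ _ hlater.injOn fun p => expMeasure 1 (t p),
    ← Finset.prod_filter_mul_prod_filter_not s (· ∈ Set.range fun a : Particle N => ((0 : ℕ), a))]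
  congr 1
  refine Finset.prod_congr (Finset.filter_congr ?_) fun _ _ => rfl
  rintro ⟨_ | n, a⟩ _ <;> simp

theorem clockLaw_apply {E : Set (ℕ × Particle N → ℝ)} (hE : MeasurableSet E) :
    clockLaw N E = ∫⁻ ε, clockLaw N {e | consClock ε e ∈ E}
      ∂Measure.pi (fun _ : Particle N => expMeasure 1) := by
  have := isProbabilityMeasure_expMeasure one_pos
  conv_lhs => rw [← map_consClock]
  rw [Measure.map_apply measurable_consClock hE, Measure.prod_apply (measurable_consClock hE)]
  rfl

theorem ae_process_zero (hlam : ∀ x, 0 < lam x) (z : State N) :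
    ∀ᵐ e ∂clockLaw N, process lam z e 0 = some z := by
  have := isProbabilityMeasure_expMeasure one_pos
  have hpos (p : ℕ × Particle N) : ∀ᵐ e ∂clockLaw N, 0 < e p :=
    (measurePreserving_eval_infinitePi (fun _ => expMeasure 1) p).quasiMeasurePreserving.ae
      (ae_pos_expMeasure one_pos)
  filter_upwards [ae_all_iff.2 hpos] with e he
  have hring : 0 < (ringChain lam z e 1).1 :=
    (div_pos (he _) (hlam _)).trans_eq (zero_add _).symm
  exact process_eq_some_iff.2 ⟨0, ⟨le_rfl, hring⟩, fun m hm => absurd hm m.not_lt_zero, rfl⟩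

/-! ### The renewal equation for the finite-dimensional distributions -/

section Path

variable {κ : Type*} {d : κ → ℝ} {w : κ → State N}

/-- The clocks for which the process started from `z` is in state `w k` at time `s + d k`, for all
`k`. -/
def pathEvent (lam : ℕ → ℝ) (d : κ → ℝ) (w : κ → State N) (z : State N) (s : ℝ) :
    Set (ℕ × Particle N → ℝ) :=
  {e | ∀ k, process lam z e (s + d k) = some (w k)}

/-- The later rounds of the clocks for which, if the first ring is that of the clock of `a` at time
`r`, the process started from `z` is in state `w k` at time `s + d k`, for all `k`. -/
def stepEvent (lam : ℕ → ℝ) (d : κ → ℝ) (w : κ → State N) (z : State N) (s : ℝ) (a : Particle N)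
    (r : ℝ) : Set (ℕ × Particle N → ℝ) :=
  {e | ∀ k, stepProcess lam z a r e (s + d k) = some (w k)}

/-- The probability that the process started from `z` is in state `w k` at time `s + d k`, for all
`k`. -/
def pathProb (lam : ℕ → ℝ) (d : κ → ℝ) (w : κ → State N) (z : State N) (s : ℝ) : ℝ :=
  (clockLaw N).real (pathEvent lam d w z s)

theorem pathProb_nonneg (z : State N) (s : ℝ) : 0 ≤ pathProb lam d w z s := measureReal_nonneg

theorem pathProb_le_one (z : State N) (s : ℝ) : pathProb lam d w z s ≤ 1 := measureReal_le_one

theorem stepEvent_of_le [Nonempty κ] (hd : ∀ k, 0 ≤ d k) (z : State N) (a : Particle N) {s r : ℝ}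
    (hr : r ≤ s) :
    stepEvent lam d w z s a r = (z.ring a).elim ∅ fun v => pathEvent lam d w v (s - r) := by
  have h (k : κ) : ¬s + d k < r := by linarith [hd k]
  simp only [stepEvent, stepProcess, if_neg (h _)]
  rcases z.ring a with _ | v
  · simp
  · simp only [Option.bind_some, Option.elim_some, pathEvent, add_sub_right_comm]

theorem stepEvent_add (z : State N) (a : Particle N) (s r : ℝ) :
    stepEvent lam d w z s a (s + r) = stepEvent lam d w z 0 a r := by
  simp only [stepEvent, stepProcess, add_lt_add_iff_left, add_sub_add_left_eq_sub, zero_add]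

theorem sum_clockRate_mul_clockLaw_stepEvent [Nonempty κ] (hlam : ∀ x, 0 ≤ lam x)
    (hd : ∀ k, 0 ≤ d k) (z : State N) {s r : ℝ} (hr : r ≤ s) :
    ∑ a, .ofReal (clockRate lam z a) * clockLaw N (stepEvent lam d w z s a r) =
      ENNReal.ofReal
        (gain (clockRate lam) State.ring (fun v => pathProb lam d w v (s - r)) z) := by
  have hrate (a : Particle N) : 0 ≤ clockRate lam z a := hlam _
  have hprob (a : Particle N) :
      0 ≤ (z.ring a).elim 0 fun v => pathProb lam d w v (s - r) := by
    cases z.ring a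
    exacts [le_rfl, pathProb_nonneg _ _]
  rw [gain_apply, ENNReal.ofReal_sum_of_nonneg fun a _ => mul_nonneg (hrate a) (hprob a)]
  refine Finset.sum_congr rfl fun a _ => ?_
  rw [ENNReal.ofReal_mul (hrate a), stepEvent_of_le hd z a hr]
  rcases z.ring a with _ | v
  · simp
  · exact congrArg (_ * ·) (ofReal_measureReal (μ := clockLaw N)).symm

variable [Countable κ]

theorem measurableSet_pathEvent_prod (z : State N) : MeasurableSet
    {p : ℝ × (ℕ × Particle N → ℝ) | p.2 ∈ pathEvent lam d w z p.1} := by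
  simp only [pathEvent, Set.mem_ofPred_eq]
  simp only [Set.ofPred_forall]
  refine .iInter fun k => ?_
  have h : Measurable fun p : ℝ × (ℕ × Particle N → ℝ) => (p.2, p.1 + d k) := by fun_prop
  exact (measurable_process z).comp h (.singleton _)

theorem measurableSet_pathEvent (z : State N) (s : ℝ) :
    MeasurableSet (pathEvent lam d w z s) :=
  measurable_prodMk_left (measurableSet_pathEvent_prod z)

theorem measurable_pathProb (z : State N) : Measurable (pathProb lam d w z) :=
  (measurable_measure_prodMk_left (measurableSet_pathEvent_prod z)).ennreal_toReal

theorem measurable_clockLaw_stepEvent (z : State N) (s : ℝ) (a : Particle N) :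
    Measurable fun r => clockLaw N (stepEvent lam d w z s a r) := by
  have h : MeasurableSet {p : ℝ × (ℕ × Particle N → ℝ) | p.2 ∈ stepEvent lam d w z s a p.1} := by
    simp only [stepEvent, Set.mem_ofPred_eq]
    simp only [Set.ofPred_forall]
    exact .iInter fun k => measurable_stepProcess z a _ (.singleton _)
  exact measurable_measure_prodMk_left h

theorem clockLaw_pathEvent (hlam : ∀ x, 0 < lam x) (hd : ∀ k, 0 ≤ d k) (z : State N) {s : ℝ}
    (hs : 0 ≤ s) :
    clockLaw N (pathEvent lam d w z s) =
      ∫⁻ r in Set.Ioi 0, .ofReal (Real.exp (-(totalRate (clockRate lam) z * r))) *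
        ∑ a, .ofReal (clockRate lam z a) * clockLaw N (stepEvent lam d w z s a r) := by
  rw [clockLaw_apply (measurableSet_pathEvent z s),
    ← lintegral_firstRing hlam z (measurable_clockLaw_stepEvent z s)]
  refine lintegral_congr fun ε => ?_
  simp only [pathEvent, stepEvent, Set.mem_ofPred_eq,
    process_consClock z ε _ (add_nonneg hs (hd _))]

theorem lintegral_Ioi_eq_lintegral_Ioi_zero_add (s : ℝ) (f : ℝ → ℝ≥0∞) :
    ∫⁻ r in Set.Ioi s, f r = ∫⁻ r in Set.Ioi 0, f (s + r) := by
  rw [← (measurePreserving_add_left volume s).setLIntegral_comp_preimage_emb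
    (measurableEmbedding_addLeft s) f (Set.Ioi s), Set.preimage_const_add_Ioi, sub_self]

variable [Nonempty κ]

theorem ofReal_pathProb (hlam : ∀ x, 0 < lam x) (hd : ∀ k, 0 ≤ d k) (z : State N) {s : ℝ}
    (hs : 0 ≤ s) :
    ENNReal.ofReal (pathProb lam d w z s) =
      ENNReal.ofReal
          (Real.exp (-(totalRate (clockRate lam) z * s)) * pathProb lam d w z 0) +
        ∫⁻ r in Set.Ioc 0 s, ENNReal.ofReal
          (renewalIntegrand (clockRate lam) State.ring (pathProb lam d w) z s r) := by
  have hmeas : Measurable fun r => ENNReal.ofReal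
      (Real.exp (-(totalRate (clockRate lam) z * r))) *
        ∑ a, .ofReal (clockRate lam z a) * clockLaw N (stepEvent lam d w z 0 a r) :=
    .mul (by fun_prop) <| Finset.measurable_sum _ fun a _ =>
      (measurable_clockLaw_stepEvent z 0 a).const_mul _
  have hdisj : Disjoint (Set.Ioc 0 s) (Set.Ioi s) := Set.Ioc_disjoint_Ioi le_rfl
  rw [pathProb, ofReal_measureReal, clockLaw_pathEvent hlam hd z hs,
    ← Set.Ioc_union_Ioi_eq_Ioi hs, lintegral_union measurableSet_Ioi hdisj, add_comm]
  congr 1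
  · rw [lintegral_Ioi_eq_lintegral_Ioi_zero_add, ENNReal.ofReal_mul (Real.exp_pos _).le, pathProb,
      ofReal_measureReal, clockLaw_pathEvent hlam hd z le_rfl, ← lintegral_const_mul _ hmeas]
    refine lintegral_congr fun r => ?_
    rw [mul_add, neg_add, Real.exp_add, ENNReal.ofReal_mul (Real.exp_pos _).le, mul_assoc]
    simp only [stepEvent_add]
  · refine setLIntegral_congr_fun measurableSet_Ioc fun r hr => ?_
    rw [renewalIntegrand, ENNReal.ofReal_mul (Real.exp_pos _).le]
    exact congrArg _ (sum_clockRate_mul_clockLaw_stepEvent (fun x => (hlam x).le) hd z hr.2)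

theorem isRenewal_pathProb (hlam : ∀ x, 0 < lam x) (hd : ∀ k, 0 ≤ d k) :
    IsRenewal (clockRate lam) State.ring (pathProb lam d w) :=
  isRenewal_of_lintegral (fun _ _ => (hlam _).le) measurable_pathProb pathProb_nonneg
    fun z _ hs => ofReal_pathProb hlam hd z hs

end Path

end Dynamics

/-! ### The transition density of the dynamics -/

section TransitionDensity

variable {lam : ℕ →ᵇ ℝ} {N : ℕ}

theorem isRenewal_kernelU (hlam : ∀ x, 0 < lam x) (z' : State N) :
    IsRenewal (clockRate lam) State.ring fun z s => kernelU lam s z z' :=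
  isRenewal_of_hasDerivAt fun z s =>
    (hasDerivAt_kernelU lam (fun x => (hlam x).ne') s z z').congr_deriv (generator_eq_gain_sub _ z)

theorem totalRate_clockRate_le (lam : ℕ →ᵇ ℝ) (z : State N) :
    totalRate (clockRate lam) z ≤ Fintype.card (Particle N) * ‖lam‖ := by
  refine (Finset.sum_le_card_nsmul _ _ ‖lam‖ fun a _ => ?_).trans_eq (nsmul_eq_mul _ _)
  exact (le_abs_self _).trans (lam.norm_coe_le_norm (z.pos a))

theorem pathProb_zero_of_ne (hlam : ∀ x, 0 < lam x) {κ : Type*} {d : κ → ℝ} {w : κ → State N}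
    {k : κ} (hk : d k = 0) {z : State N} (hz : z ≠ w k) : pathProb lam d w z 0 = 0 := by
  have hempty : pathEvent lam d w z 0 =ᵐ[clockLaw N] (∅ : Set (ℕ × Particle N → ℝ)) := by
    filter_upwards [ae_process_zero hlam z] with e he
    refine eq_false fun h => hz (Option.some_injective _ ?_)
    rw [← he, ← h k, hk, add_zero]
  rw [pathProb, measureReal_congr hempty, measureReal_empty]

theorem pathProb_eq_kernelU_mul (hlam : ∀ x, 0 < lam x) {κ : Type*} [Countable κ] {d : κ → ℝ}
    (hd : ∀ k, 0 ≤ d k) {k : κ} (hk : d k = 0) (w : κ → State N) (z : State N) {s : ℝ}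
    (hs : 0 ≤ s) :
    pathProb lam d w z s = kernelU lam s z (w k) * pathProb lam d w (w k) 0 := by
  have : Nonempty κ := ⟨k⟩
  have hlam' (x : ℕ) : lam x ≠ 0 := (hlam x).ne'
  set c := pathProb lam d w (w k) 0
  obtain ⟨K, hK⟩ := exists_abs_kernelU_le lam hlam' (w k) s
  have hrenewal := (isRenewal_pathProb (w := w) hlam hd).sub ((isRenewal_kernelU hlam (w k)).smul c)
  rw [mul_comm, ← sub_eq_zero]
  refine hrenewal.eq_zero (fun _ _ => (hlam _).le) (fun v => ?_) (totalRate_clockRate_le lam)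
    (K := 1 + |c| * K) (fun v r hr => ?_) hs z
  · change pathProb lam d w v 0 - c * kernelU lam 0 v (w k) = 0
    by_cases hv : v = w k
    · rw [hv, kernelU_zero_self lam hlam', mul_one, sub_self]
    · rw [kernelU_zero_of_ne lam hlam' hv, pathProb_zero_of_ne hlam hk hv, mul_zero, sub_zero]
  · refine (abs_sub _ _).trans (add_le_add ?_ ?_)
    · rw [abs_of_nonneg (pathProb_nonneg v r)]
      exact pathProb_le_one v r
    · exact (abs_mul _ _).trans_le (mul_le_mul_of_nonneg_left (hK r hr v) (abs_nonneg c))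

theorem clockLaw_process_eq (hlam : ∀ x, 0 < lam x) (z z' : State N) {t : ℝ} (ht : 0 ≤ t) :
    (clockLaw N).real {e | process lam z e t = some z'} = kernelU lam t z z' := by
  have hevent (z : State N) (t : ℝ) : pathProb lam (fun _ : Unit => 0) (fun _ => z') z t =
      (clockLaw N).real {e | process lam z e t = some z'} := by
    simp only [pathProb, pathEvent, add_zero, forall_const]
  have hzero : (clockLaw N).real {e | process lam z' e 0 = some z'} = 1 :=
    (measureReal_congr (Filter.eventuallyEq_univ.2 (ae_process_zero hlam z'))).trans probReal_univ
  rw [← hevent, pathProb_eq_kernelU_mul hlam (fun _ => le_rfl) (k := ()) rfl _ z ht, hevent, hzero,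
    mul_one]

theorem kernelU_nonneg (hlam : ∀ x, 0 < lam x) {t : ℝ} (ht : 0 ≤ t) (z z' : State N) :
    0 ≤ kernelU lam t z z' :=
  clockLaw_process_eq hlam z z' ht ▸ measureReal_nonneg

theorem measurableSet_process_eq (lam : ℕ → ℝ) (z z' : State N) (t : ℝ) :
    MeasurableSet {e | process lam z e t = some z'} :=
  measurable_prodMk_right (measurable_process z (.singleton (some z')))

theorem sum_kernelU_le_one (hlam : ∀ x, 0 < lam x) {t : ℝ} (ht : 0 ≤ t) (z : State N)
    (S : Finset (State N)) : ∑ z' ∈ S, kernelU lam t z z' ≤ 1 := by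
  simp only [← clockLaw_process_eq hlam z _ ht]
  rw [← measureReal_biUnion_finset]
  · exact measureReal_le_one
  · intro u _ v _ huv
    exact Set.disjoint_left.2 fun e hu hv =>
      huv (Option.some_injective _ ((Eq.symm hu).trans hv))
  · exact fun z' _ => measurableSet_process_eq lam z z' t

theorem clockLaw_process_path_succ (hlam : ∀ x, 0 < lam x) (n : ℕ) {t : ℕ → ℝ} (w : ℕ → State N)
    (ht0 : t 0 = 0) (ht : Monotone t) :
    (clockLaw N).real {e | ∀ k ≤ n + 1, process lam (w 0) e (t k) = some (w k)} =
      kernelU lam (t 1) (w 0) (w 1) * (clockLaw N).real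
        {e | ∀ k ≤ n, process lam (w 1) e (t (k + 1) - t 1) = some (w (k + 1))} := by
  have hpath (z : State N) (s : ℝ) :
      pathProb lam (fun k : Set.Iic n => t (k + 1) - t 1) (fun k => w (k + 1)) z s =
        (clockLaw N).real
          {e | ∀ k ≤ n, process lam z e (s + (t (k + 1) - t 1)) = some (w (k + 1))} := by
    simp only [pathProb, pathEvent, Subtype.forall, Set.mem_Iic]
  have hmarkov := pathProb_eq_kernelU_mul hlam (d := fun k : Set.Iic n => t (k + 1) - t 1)
    (k := ⟨0, n.zero_le⟩) (fun k => sub_nonneg.2 (ht (by lia))) (sub_self _) (fun k => w (k + 1))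
    (w 0) (s := t 1) (ht0 ▸ ht (Nat.zero_le 1))
  rw [hpath, hpath] at hmarkov
  simp only [add_sub_cancel, zero_add] at hmarkov
  rw [← hmarkov]
  refine measureReal_congr ?_
  filter_upwards [ae_process_zero hlam (w 0)] with e he
  refine propext ⟨fun h k hk => h (k + 1) (by lia), fun h k hk => ?_⟩
  rcases k with _ | k
  · rwa [ht0]
  · exact h k (by lia)

theorem clockLaw_process_path (hlam : ∀ x, 0 < lam x) (n : ℕ) (t : ℕ → ℝ) (w : ℕ → State N)
    (ht0 : t 0 = 0) (ht : Monotone t) :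
    (clockLaw N).real {e | ∀ k ≤ n, process lam (w 0) e (t k) = some (w k)} =
      ∏ k ∈ Finset.range n, kernelU lam (t (k + 1) - t k) (w k) (w (k + 1)) := by
  induction n generalizing t w with
  | zero =>
    have hsure : {e | ∀ k ≤ 0, process lam (w 0) e (t k) = some (w k)} =ᵐ[clockLaw N] Set.univ := by
      filter_upwards [ae_process_zero hlam (w 0)] with e he
      exact eq_true fun k hk => by rwa [Nat.le_zero.1 hk, ht0]
    rw [measureReal_congr hsure, probReal_univ, Finset.prod_range_zero]
  | succ n ih =>
    have hrest := ih (fun k => t (k + 1) - t 1) (fun k => w (k + 1)) (sub_self _)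
      fun i j hij => sub_le_sub_right (ht (by lia)) _
    simp only [sub_sub_sub_cancel_right, zero_add] at hrest
    rw [clockLaw_process_path_succ hlam n w ht0 ht, hrest, Finset.prod_range_succ', mul_comm,
      zero_add, ht0, sub_zero]

end TransitionDensity

end

end TwoLevel

open MeasureTheory ProbabilityTheory TwoLevel in
theorem mainTheorem4_general (N : ℕ) (lam : ℕ → ℝ) (hpos : ∀ x, 0 < lam x)
    (hbdd : BddAbove (Set.range lam)) :
    (∀ t : ℝ, 0 ≤ t → ∀ z z' : State N, 0 ≤ kernelU lam t z z') ∧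
    (∀ t : ℝ, 0 ≤ t → ∀ z : State N,
      Summable (fun z' : State N => kernelU lam t z z') ∧
        ∑' z' : State N, kernelU lam t z z' ≤ 1) ∧
    (∀ z z' : State N, (z = z' → kernelU lam 0 z z' = 1) ∧ (z ≠ z' → kernelU lam 0 z z' = 0)) ∧
    (∀ t : ℝ, 0 ≤ t → ∀ z z' : State N,
      HasDerivWithinAt (fun r => kernelU lam r z z')
        (generator lam (fun w => kernelU lam t w z') z) (Set.Ici 0) t) ∧
    (∀ (Ω : Type*) [MeasurableSpace Ω] (P : Measure Ω) [IsProbabilityMeasure P]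
      (e : ℕ × Particle N → Ω → ℝ),
      (∀ p, Measurable (e p)) → (∀ p, P.map (e p) = expMeasure 1) → iIndepFun e P →
      ∀ (n : ℕ) (t : ℕ → ℝ) (w : ℕ → State N), t 0 = 0 → Monotone t →
        P.real {ω | ∀ k ≤ n, process lam (w 0) (fun p => e p ω) (t k) = some (w k)} =
          ∏ k ∈ Finset.range n, kernelU lam (t (k + 1) - t k) (w k) (w (k + 1))) := by
  obtain ⟨M, hM⟩ := hbdd
  obtain ⟨lam, rfl⟩ : ∃ l : BoundedContinuousFunction ℕ ℝ, ⇑l = lam :=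
    ⟨.ofNormedAddCommGroupDiscrete lam M fun x =>
      (Real.norm_of_nonneg (hpos x).le).trans_le (hM (Set.mem_range_self x)), rfl⟩
  have hne (x : ℕ) : lam x ≠ 0 := (hpos x).ne'
  refine ⟨fun t ht z z' => kernelU_nonneg hpos ht z z', fun t ht z => ?_, fun z z' => ?_,
    fun t _ z z' => (hasDerivAt_kernelU lam hne t z z').hasDerivWithinAt, ?_⟩
  · have hsum := summable_of_sum_le (kernelU_nonneg hpos ht z) (sum_kernelU_le_one hpos ht z)
    exact ⟨hsum, hsum.tsum_le_of_sum_le (sum_kernelU_le_one hpos ht z)⟩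
  · exact ⟨fun h => h ▸ kernelU_zero_self lam hne z, kernelU_zero_of_ne lam hne⟩
  · intro Ω _ P _ e hm hlaw hind n t w ht0 ht
    have hpath : MeasurableSet {e | ∀ k ≤ n, process lam (w 0) e (t k) = some (w k)} := by
      simp only [Set.ofPred_forall]
      exact .iInter fun k => .iInter fun _ => measurableSet_process_eq lam _ _ _
    rw [← clockLaw_process_path hpos n t w ht0 ht, ← map_eq_clockLaw hm hlaw hind,
      map_measureReal_apply (measurable_pi_iff.2 hm) hpath]
    rfl

open MeasureTheory ProbabilityTheory TwoLevel in
theorem mainTheorem4 (N : ℕ) (lam : ℕ → ℝ) (hlam : UniformlyBounded lam) :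
    -- nonnegative and substochastic
    (∀ t : ℝ, 0 ≤ t → ∀ z z' : State N, 0 ≤ kernelU lam t z z') ∧
    (∀ t : ℝ, 0 ≤ t → ∀ z : State N,
      Summable (fun z' : State N => kernelU lam t z z') ∧
        ∑' z' : State N, kernelU lam t z z' ≤ 1) ∧
    -- the initial condition and the Kolmogorov backward equation
    (∀ z z' : State N, (z = z' → kernelU lam 0 z z' = 1) ∧ (z ≠ z' → kernelU lam 0 z z' = 0)) ∧
    (∀ t : ℝ, 0 ≤ t → ∀ z z' : State N,
      HasDerivWithinAt (fun r => kernelU lam r z z')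
        (generator lam (fun w => kernelU lam t w z') z) (Set.Ici 0) t) ∧
    -- the finite-dimensional distributions of the dynamics have the transition density `kernelU`
    (∀ (Ω : Type*) [MeasurableSpace Ω] (P : Measure Ω) [IsProbabilityMeasure P]
      (e : ℕ × Particle N → Ω → ℝ),
      (∀ p, Measurable (e p)) → (∀ p, P.map (e p) = expMeasure 1) → iIndepFun e P →
      ∀ (n : ℕ) (t : ℕ → ℝ) (w : ℕ → State N), t 0 = 0 → Monotone t →
        P.real {ω | ∀ k ≤ n, process lam (w 0) (fun p => e p ω) (t k) = some (w k)} =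
          ∏ k ∈ Finset.range n, kernelU lam (t (k + 1) - t k) (w k) (w (k + 1))) := by
  obtain ⟨s, M, hs, h⟩ := hlam
  exact mainTheorem4_general N lam (fun x => hs.trans_le (h x).1)
    ⟨M, Set.forall_mem_range.2 fun x => (h x).2⟩
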